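/- Let $p\in(0,1)$ and let $X_1,X_2,\dots$ be i.i.d. real random variables with distribution function $F$. Assume that $F$ has a unique $p$-th quantile $\mu$ (the only $x$ with $P(X_1<x)\le p\le P(X_1\le x)$), that in a neighborhood of $\mu$ the law of $X_1$ has a density $f$ which is positive and continuous there, that $F\in\mathbb S_1(\mu)$, i.e. $F$ is Lipschitz in a neighborhood of $\mu$, and that $E|X_1|^\alpha<\infty$ for some $\alpha>0$. Let $m=m_n$ be positive integers for large $n$ with $m_n\to\infty$ and $m_n=o(n)$ as $n\to\infty$. Let $\bar F(t)=n^{-1}\sum_{i=1}^n\mathbf 1\{X_i\le t\}$ and $\hat\mu_n=\inf\{t:\bar F(t)\ge p\}$. Given $X_1,\dots,X_n$, let $X_1^*,\dots,X_m^*$ be i.i.d. draws from $\bar F$, let $F_n^{(m)}(t)=m^{-1}\sum_{j=1}^m\mathbf 1\{X_j^*\le t\}$ and $\hat\mu_m^{(boot)}=\inf\{t:F_n^{(m)}(t)\ge p\}$. Let $(\hat\sigma_m^{(boot)})^2$ be the conditional variance of $\sqrt m(\hat\mu_m^{(boot)}-\hat\mu_n)$ given $X_1,\dots,X_n$. Then,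 as $n\to\infty$, $$(\hat\sigma_m^{(boot)})^2\xrightarrow{a.s.}\frac{p(1-p)}{f(\mu)^2},$$ and $$T_m^{(boot)}=\frac{\sqrt m\,(\hat\mu_m^{(boot)}-\hat\mu_n)}{\hat\sigma_m^{(boot)}}\xrightarrow{d}N(0,1),$$ where the convergence in distribution holds unconditionally and also conditionally on the data: almost surely, $P(T_m^{(boot)}\le t\mid X_1,\dots,X_n)\to\Phi(t)$ for every $t\in\mathbb R$, where $\Phi$ is the standard normal distribution function. -/

import Mathlib

open MeasureTheory ProbabilityTheory Filter Topology

noncomputable section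

namespace QuantileBootstrap

/-- `x` is a `p`-th quantile of the law `ν`: `ν (-∞, x) ≤ p ≤ ν (-∞, x]`. -/
def IsQuantile (ν : Measure ℝ) (p x : ℝ) : Prop :=
  ν.real (Set.Iio x) ≤ p ∧ p ≤ ν.real (Set.Iic x)

/-- `μ` is the unique `p`-th quantile of the law `ν`. -/
def IsUniqueQuantile (ν : Measure ℝ) (p μ : ℝ) : Prop :=
  ∀ x : ℝ, IsQuantile ν p x ↔ x = μ

/-- The smoothness class of order `L` at `μ`, for `L ≥ 1`: near `μ`, the derivative of order `L - 1`
of `g` exists and is Lipschitz. For `L = 1`, `g` itself is Lipschitz in a neighborhood of `μ`. -/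
def SobolevSmoothAt (L : ℕ) (μ : ℝ) (g : ℝ → ℝ) : Prop :=
  ContDiffAt ℝ ((L - 1 : ℕ) : WithTop ℕ∞) g μ ∧
    ∃ (K : NNReal), ∃ U ∈ 𝓝 μ, LipschitzOnWith K (iteratedDeriv (L - 1) g) U

/-- In some open neighborhood of `μ`, the law `ν` has density `f` with respect to Lebesgue measure,
and `f` is positive and continuous there. -/
def HasPosContDensityNear (ν : Measure ℝ) (f : ℝ → ℝ) (μ : ℝ) : Prop :=
  ∃ U : Set ℝ, IsOpen U ∧ μ ∈ U ∧ ContinuousOn f U ∧ (∀ x ∈ U, 0 < f x) ∧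
    ν.restrict U = (volume.restrict U).withDensity (fun x => ENNReal.ofReal (f x))

/-- The empirical distribution function `t ↦ k⁻¹ #{i : x i ≤ t}` of a finite sample. -/
def ecdf {k : ℕ} (x : Fin k → ℝ) (t : ℝ) : ℝ :=
  (k : ℝ)⁻¹ * ∑ i, Set.indicator (Set.Iic t) (fun _ => (1 : ℝ)) (x i)

/-- The `p`-th sample quantile `inf {t : ecdf x t ≥ p}`. -/
def sampleQuantile (p : ℝ) {k : ℕ} (x : Fin k → ℝ) : ℝ :=
  sInf {t : ℝ | p ≤ ecdf x t}

/-- The empirical distribution `n⁻¹ ∑ δ_{x i}` of a finite sample. -/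
def empiricalMeasure {n : ℕ} (x : Fin n → ℝ) : Measure ℝ :=
  (n : ENNReal)⁻¹ • ∑ i, Measure.dirac (x i)

/-- The conditional law given the sample `x` of an i.i.d. resample of size `m` drawn from the
empirical distribution of `x`. -/
def resampleLaw (m : ℕ) {n : ℕ} (x : Fin n → ℝ) : Measure (Fin m → ℝ) :=
  Measure.pi (fun _ => empiricalMeasure x)

/-- The conditional variance, given the sample `x`, of `√m (bootstrap quantile - sample quantile)`,
the bootstrap quantile being the sample quantile of a resample of size `m`. -/
def bootVariance (p : ℝ) (m : ℕ) {n : ℕ} (x : Fin n → ℝ) : ℝ :=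
  variance (fun y : Fin m → ℝ => √(m : ℝ) * (sampleQuantile p y - sampleQuantile p x))
    (resampleLaw m x)

/-- The Studentized bootstrap quantile computed from the sample `x` and the resample `y`. -/
def studentized (p : ℝ) {m n : ℕ} (x : Fin n → ℝ) (y : Fin m → ℝ) : ℝ :=
  √(m : ℝ) * (sampleQuantile p y - sampleQuantile p x) / √(bootVariance p m x)

end QuantileBootstrap

end

/-!
The bootstrap quantile is at most `τ` exactly when a binomial proportion with success probability
`ecdf x τ` is at least `p` (`sampleQuantile_le_iff`). So, conditionally on the data, everything is a
statement about a triangular array of laws `ν n` (the empirical laws) and about the values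
`ν n (-∞, c n + u]` near the sample quantiles `c n`. The proof has a probabilistic part about the
resampling, valid for any such array, and a part checking its hypotheses for almost every
realization of the data.

*Triangular arrays.* Suppose that `ν n (-∞, c n + u] = p + f₀ u + o(|u| + 1 / √m)` uniformly as
`u → 0` and `n → ∞`, that the `c n` are bounded, and that the `ν n` have bounded moments of some
order `α > 0`.
Lévy's continuity theorem for the binomial proportions gives, for the sample quantile `Q` of `m`
draws from `ν n`, the limit law `N(0, p (1 - p) / f₀ ^ 2)` of `√m (Q - c n)`
(`tendsto_measureReal_sqrt_mul_sampleQuantile_sub_le`). For the variances,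
`exists_tail_bound` bounds the tail of `√m (Q - c n)` by a multiple of `t ^ (-4)`, uniformly in `n`:
up to a fixed multiple of `√m` by the Gaussian Chernoff bound, and beyond it because `Q` can be far
out only if a fixed fraction of the `m` draws is, which has probability at most `(2 q ^ r) ^ m` when
each draw is far out with probability `q`. The last bound decays like a power of the distance whose
exponent is proportional to `m`, so that any `α > 0` is enough and no relation between `m` and
`log n` is needed. The layer cake formula and dominated convergence then give convergence of the
variances.

*The data.* Near `μ` the empirical distribution function has increments
`f μ (t - s) + o((t - s) + 1 / √n)`, almost surely and uniformly (`ae_exists_abs_ecdf_sub_le`): on a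
grid of mesh `η / √n` the empirical measure of a cell is off by more than `η` times the mesh with
probability at most `2 exp (-c √n)`, and there are `O(√n)` cells. Since
`m ≤ n` eventually, this is the local linearity required above, after recentring at the sample
quantile. The moment bound is the strong law of large numbers for `|X i| ^ α`.

Unconditional convergence follows from conditional convergence by dominated convergence.
-/

namespace QuantileBootstrap

/-! ### Chernoff bounds for counts in an i.i.d. sample -/

theorem integral_exp_mul_indicator (ν : Measure ℝ) [IsProbabilityMeasure ν] {A : Set ℝ}
    (hA : MeasurableSet A) (l : ℝ) :
    ∫ x, Real.exp (l * A.indicator (fun _ => (1 : ℝ)) x) ∂ν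
      = 1 + ν.real A * (Real.exp l - 1) := by
  have h : (fun x => Real.exp (l * A.indicator (fun _ => (1 : ℝ)) x))
      = fun x => 1 + A.indicator (fun _ => Real.exp l - 1) x := by
    funext x
    by_cases hx : x ∈ A <;> simp [hx]
  rw [h, integral_add (integrable_const _) ((integrable_const _).indicator hA),
    integral_indicator_const _ hA]
  simp

theorem measureReal_mul_sum_indicator_ge_le (ν : Measure ℝ) [IsProbabilityMeasure ν] {A : Set ℝ}
    (hA : MeasurableSet A) (k : ℕ) (l a : ℝ) :
    (Measure.pi (fun _ : Fin k => ν)).real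
        {y | a ≤ l * ∑ i, A.indicator (fun _ => (1 : ℝ)) (y i)}
      ≤ Real.exp (-a) * (1 + ν.real A * (Real.exp l - 1)) ^ k := by
  have hind : Measurable (A.indicator (fun _ => (1 : ℝ))) := measurable_const.indicator hA
  have hprod : ∀ y : Fin k → ℝ, Real.exp (l * ∑ i, A.indicator (fun _ => (1 : ℝ)) (y i))
      = ∏ i, Real.exp (l * A.indicator (fun _ => (1 : ℝ)) (y i)) := by
    intro y
    rw [Finset.mul_sum, Real.exp_sum]
  have hint1 : Integrable (fun x => Real.exp (l * A.indicator (fun _ => (1 : ℝ)) x)) ν := by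
    refine Integrable.of_bound (by fun_prop) (Real.exp |l|) (ae_of_all _ fun x => ?_)
    rw [Real.norm_eq_abs, Real.abs_exp, Real.exp_le_exp]
    by_cases hx : x ∈ A
    · simpa [hx] using le_abs_self l
    · simp [hx]
  have hint : Integrable (fun y : Fin k → ℝ =>
      Real.exp (l * ∑ i, A.indicator (fun _ => (1 : ℝ)) (y i)))
      (Measure.pi (fun _ : Fin k => ν)) := by
    simp_rw [hprod]
    exact Integrable.fintype_prod (f := fun _ x => Real.exp (l * A.indicator (fun _ => (1 : ℝ)) x))
      (fun _ => hint1)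
  have hmk := mul_meas_ge_le_integral_of_nonneg (ae_of_all _ fun y => (Real.exp_pos _).le) hint
    (Real.exp a)
  have hset : {y : Fin k → ℝ | Real.exp a
      ≤ Real.exp (l * ∑ i, A.indicator (fun _ => (1 : ℝ)) (y i))}
      = {y | a ≤ l * ∑ i, A.indicator (fun _ => (1 : ℝ)) (y i)} := by
    ext y; simp
  rw [hset] at hmk
  simp_rw [hprod] at hmk
  rw [integral_fintype_prod_eq_pow (fun x => Real.exp (l * A.indicator (fun _ => (1 : ℝ)) x)),
    integral_exp_mul_indicator ν hA, Fintype.card_fin] at hmk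
  rw [Real.exp_neg, inv_mul_eq_div, le_div_iff₀ (Real.exp_pos a), mul_comm]
  exact hmk

/-- The quadratic form of the Chernoff bound, from `exp l - 1 ≤ l + l ^ 2` for `|l| ≤ 1`. The
success probability is kept in the exponent, which matters for sets of small measure. -/
theorem measureReal_mul_sum_indicator_ge_le_exp (ν : Measure ℝ) [IsProbabilityMeasure ν]
    {A : Set ℝ} (hA : MeasurableSet A) (k : ℕ) {l : ℝ} (hl : |l| ≤ 1) (a : ℝ) :
    (Measure.pi (fun _ : Fin k => ν)).real
        {y | a ≤ l * ∑ i, A.indicator (fun _ => (1 : ℝ)) (y i)}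
      ≤ Real.exp (-a + k * (ν.real A * (l + l ^ 2))) := by
  refine (measureReal_mul_sum_indicator_ge_le ν hA k l a).trans ?_
  rw [Real.exp_add, Real.exp_nat_mul]
  have h1 : Real.exp l - 1 ≤ l + l ^ 2 := by
    have := (abs_le.1 (Real.abs_exp_sub_one_sub_id_le hl)).2
    linarith
  have h0 : 0 ≤ 1 + ν.real A * (Real.exp l - 1) := by
    have h2 : 0 < Real.exp l := Real.exp_pos l
    have h3 : ν.real A ≤ 1 := measureReal_le_one
    have h4 : 0 ≤ ν.real A := measureReal_nonneg
    nlinarith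
  gcongr
  calc 1 + ν.real A * (Real.exp l - 1) ≤ 1 + ν.real A * (l + l ^ 2) := by gcongr
    _ ≤ Real.exp (ν.real A * (l + l ^ 2)) := by
        rw [add_comm]; exact Real.add_one_le_exp _

theorem measureReal_sum_indicator_le_le (ν : Measure ℝ) [IsProbabilityMeasure ν] {A : Set ℝ}
    (hA : MeasurableSet A) (k : ℕ) {r : ℝ} (hr0 : 0 ≤ r) (hr2 : r ≤ 2) :
    (Measure.pi (fun _ : Fin k => ν)).real
        {y | ∑ i, A.indicator (fun _ => (1 : ℝ)) (y i) ≤ k * (ν.real A - r)}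
      ≤ Real.exp (-(k * r ^ 2 / 4)) := by
  have h := measureReal_mul_sum_indicator_ge_le_exp ν hA k (l := -(r / 2))
    (by rw [abs_neg, abs_of_nonneg] <;> linarith) (-(r / 2) * (k * (ν.real A - r)))
  refine (measureReal_mono ?_).trans (h.trans ?_)
  · intro y hy
    simp only [Set.mem_ofPred_eq] at hy ⊢
    nlinarith
  · rw [Real.exp_le_exp]
    have h3 : ν.real A ≤ 1 := measureReal_le_one
    have : (k : ℝ) * ν.real A * r ^ 2 ≤ k * 1 * r ^ 2 := by gcongr
    nlinarith

theorem measureReal_sum_indicator_ge_le (ν : Measure ℝ) [IsProbabilityMeasure ν] {A : Set ℝ}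
    (hA : MeasurableSet A) (k : ℕ) {r : ℝ} (hr0 : 0 ≤ r) (hr2 : r ≤ 2) :
    (Measure.pi (fun _ : Fin k => ν)).real
        {y | k * (ν.real A + r) ≤ ∑ i, A.indicator (fun _ => (1 : ℝ)) (y i)}
      ≤ Real.exp (-(k * r ^ 2 / 4)) := by
  have h := measureReal_mul_sum_indicator_ge_le_exp ν hA k (l := r / 2)
    (by rw [abs_of_nonneg] <;> linarith) (r / 2 * (k * (ν.real A + r)))
  refine (measureReal_mono ?_).trans (h.trans ?_)
  · intro y hy
    simp only [Set.mem_ofPred_eq] at hy ⊢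
    nlinarith
  · rw [Real.exp_le_exp]
    have h3 : ν.real A ≤ 1 := measureReal_le_one
    have : (k : ℝ) * ν.real A * r ^ 2 ≤ k * 1 * r ^ 2 := by gcongr
    nlinarith

/-- The large deviation bound for a set of small measure: a fraction `r` of the sample falls into
a set of measure at most `q` with probability at most `(2 q ^ r) ^ k`. -/
theorem measureReal_sum_indicator_ge_le_rpow (ν : Measure ℝ) [IsProbabilityMeasure ν] {A : Set ℝ}
    (hA : MeasurableSet A) (k : ℕ) (r : ℝ) {q : ℝ} (hq0 : 0 < q)
    (hq1 : q ≤ 1) (hAq : ν.real A ≤ q) :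
    (Measure.pi (fun _ : Fin k => ν)).real
        {y | k * r ≤ ∑ i, A.indicator (fun _ => (1 : ℝ)) (y i)}
      ≤ (2 * q ^ r) ^ k := by
  -- the exponent `l` of the Chernoff bound with `exp l = q⁻¹`
  have hl : 0 ≤ -Real.log q := neg_nonneg.2 (Real.log_nonpos hq0.le hq1)
  have h := measureReal_mul_sum_indicator_ge_le ν hA k (-Real.log q) (-Real.log q * (k * r))
  refine (measureReal_mono ?_).trans (h.trans ?_)
  · intro y hy
    simp only [Set.mem_ofPred_eq] at hy ⊢
    gcongr
  · have h1 : Real.exp (-(-Real.log q * (k * r))) = (q ^ r) ^ k := by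
      rw [Real.rpow_def_of_pos hq0, ← Real.exp_nat_mul]
      ring_nf
    rw [h1, mul_comm 2, mul_pow, Real.exp_neg, Real.exp_log hq0]
    have h4 : 0 ≤ ν.real A := measureReal_nonneg
    have h5 : 1 ≤ q⁻¹ := (one_le_inv₀ hq0).2 hq1
    have h6 : ν.real A * (q⁻¹ - 1) ≤ 1 := by
      calc ν.real A * (q⁻¹ - 1) ≤ q * (q⁻¹ - 1) := by
            apply mul_le_mul_of_nonneg_right hAq; linarith
        _ = 1 - q := by field_simp
        _ ≤ 1 := by linarith
    have h7 : 0 ≤ ν.real A * (q⁻¹ - 1) := mul_nonneg h4 (by linarith)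
    gcongr
    linarith

/-! ### Sample quantiles and empirical laws -/

theorem ecdf_mono {k : ℕ} (x : Fin k → ℝ) : Monotone (ecdf x) := by
  intro s t hst
  unfold ecdf
  gcongr

theorem ecdf_sub_ecdf {k : ℕ} (x : Fin k → ℝ) {s t : ℝ} (hst : s ≤ t) :
    ecdf x t - ecdf x s
      = (k : ℝ)⁻¹ * ∑ i, (Set.Ioc s t).indicator (fun _ => (1 : ℝ)) (x i) := by
  unfold ecdf
  rw [← mul_sub, ← Finset.sum_sub_distrib]
  congr 1
  refine Finset.sum_congr rfl fun i _ => ?_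
  by_cases h1 : x i ≤ s
  · simp [h1, h1.trans hst]
  · by_cases h2 : x i ≤ t <;> simp [h1, h2, not_le.1 h1]

theorem exists_ecdf_eq_zero {k : ℕ} (x : Fin k → ℝ) : ∃ B, ∀ t < B, ecdf x t = 0 := by
  obtain ⟨B, hB⟩ := (Set.finite_range x).bddBelow
  refine ⟨B, fun t ht => ?_⟩
  unfold ecdf
  rw [Finset.sum_eq_zero, mul_zero]
  intro i _
  have : t < x i := ht.trans_le (hB ⟨i, rfl⟩)
  simp [this]

theorem exists_ecdf_eq_one {k : ℕ} (hk : k ≠ 0) (x : Fin k → ℝ) : ∃ B, ecdf x B = 1 := by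
  obtain ⟨B, hB⟩ := (Set.finite_range x).bddAbove
  refine ⟨B, ?_⟩
  unfold ecdf
  have : ∀ i, x i ≤ B := fun i => hB ⟨i, rfl⟩
  simp [this, hk]

/-- Closedness is what makes the infimum in `sampleQuantile` attained. -/
theorem isClosed_setOf_le_ecdf {k : ℕ} (p : ℝ) (x : Fin k → ℝ) :
    IsClosed {t | p ≤ ecdf x t} := by
  have husc : UpperSemicontinuous (ecdf x) := by
    have h1 : ∀ i, UpperSemicontinuous
        (fun t => (Set.Ici (x i)).indicator (fun _ => (1 : ℝ)) t) :=
      fun i => isClosed_Ici.upperSemicontinuous_indicator zero_le_one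
    have h2 : UpperSemicontinuous
        (fun t => ∑ i, (Set.Ici (x i)).indicator (fun _ => (1 : ℝ)) t) :=
      upperSemicontinuous_sum fun i _ => h1 i
    have h3 : ecdf x
        = (fun s : ℝ => (k : ℝ)⁻¹ * s) ∘
          (fun t => ∑ i, (Set.Ici (x i)).indicator (fun _ => (1 : ℝ)) t) := by
      funext t
      unfold ecdf
      simp [Set.indicator_apply]
    rw [h3]
    exact Continuous.comp_upperSemicontinuous (by fun_prop) h2
      (fun a b hab => by gcongr)
  exact upperSemicontinuous_iff_isClosed_preimage.1 husc p

/-- The sample quantile as a Galois inverse of the empirical distribution function. -/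
theorem sampleQuantile_le_iff {p : ℝ} (hp0 : 0 < p) (hp1 : p ≤ 1) {k : ℕ} (hk : k ≠ 0)
    (x : Fin k → ℝ) (t : ℝ) : sampleQuantile p x ≤ t ↔ p ≤ ecdf x t := by
  have hbdd : BddBelow {t : ℝ | p ≤ ecdf x t} := by
    obtain ⟨B, hB⟩ := exists_ecdf_eq_zero x
    refine ⟨B, fun s hs => ?_⟩
    by_contra! h
    have := hB s h
    simp only [Set.mem_ofPred_eq] at hs
    linarith
  have hne : {t : ℝ | p ≤ ecdf x t}.Nonempty := by
    obtain ⟨B, hB⟩ := exists_ecdf_eq_one hk x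
    exact ⟨B, by simpa [hB] using hp1⟩
  constructor
  · intro h
    have hmem : sampleQuantile p x ∈ {t : ℝ | p ≤ ecdf x t} :=
      (isClosed_setOf_le_ecdf p x).csInf_mem hne hbdd
    exact le_trans hmem (ecdf_mono x h)
  · exact fun h => csInf_le hbdd h

theorem measurable_ecdf {k : ℕ} (t : ℝ) : Measurable (fun x : Fin k → ℝ => ecdf x t) := by
  unfold ecdf
  have : Measurable ((Set.Iic t).indicator (fun _ => (1 : ℝ))) :=
    measurable_const.indicator measurableSet_Iic
  fun_prop

theorem measurable_sampleQuantile {p : ℝ} (hp0 : 0 < p) (hp1 : p ≤ 1) (k : ℕ) :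
    Measurable (fun x : Fin k → ℝ => sampleQuantile p x) := by
  rcases eq_or_ne k 0 with rfl | hk
  · exact measurable_of_countable _
  refine measurable_of_Iic fun t => ?_
  have : (fun x : Fin k → ℝ => sampleQuantile p x) ⁻¹' Set.Iic t = {x | p ≤ ecdf x t} := by
    ext x
    simp [sampleQuantile_le_iff hp0 hp1 hk]
  rw [this]
  exact measurableSet_le measurable_const (measurable_ecdf t)

theorem isProbabilityMeasure_empiricalMeasure {n : ℕ} (hn : n ≠ 0) (x : Fin n → ℝ) :
    IsProbabilityMeasure (empiricalMeasure x) := by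
  constructor
  simp [empiricalMeasure, ENNReal.inv_mul_cancel, hn]

theorem integral_empiricalMeasure {n : ℕ} (x : Fin n → ℝ) (g : ℝ → ℝ) :
    ∫ t, g t ∂(empiricalMeasure x) = (n : ℝ)⁻¹ * ∑ i, g (x i) := by
  unfold empiricalMeasure
  rw [integral_smul_measure, integral_finsetSum_measure fun i _ => integrable_dirac (by simp)]
  simp

theorem measureReal_Iic_empiricalMeasure {n : ℕ} (x : Fin n → ℝ) (t : ℝ) :
    (empiricalMeasure x).real (Set.Iic t) = ecdf x t := by
  rw [← integral_indicator_one measurableSet_Iic, integral_empiricalMeasure]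
  rfl

/-! ### Central limit theorem for sample quantiles -/

theorem tendsto_one_add_pow_comp_exp {m : ℕ → ℕ} (hm : Tendsto m atTop atTop) {g : ℕ → ℂ} {w : ℂ}
    (hg : Tendsto (fun n => (m n : ℂ) * g n) atTop (𝓝 w)) :
    Tendsto (fun n => (1 + g n) ^ m n) atTop (𝓝 (Complex.exp w)) := by
  have hm' : Tendsto (fun n => ((m n : ℂ))⁻¹) atTop (𝓝 0) :=
    tendsto_inv_atTop_nhds_zero_nat (𝕜 := ℂ) |>.comp hm
  have hpos : ∀ᶠ n in atTop, m n ≠ 0 := hm.eventually_ne_atTop 0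
  have hg0 : Tendsto g atTop (𝓝 0) := by
    have := hm'.mul hg
    rw [zero_mul] at this
    refine this.congr' ?_
    filter_upwards [hpos] with n hn
    field_simp
  have hlog : Tendsto (fun n => (m n : ℂ) * Complex.log (1 + g n)) atTop (𝓝 w) := by
    have hO := (Complex.log_sub_self_isBigO.comp_tendsto hg0)
    have hO2 : (fun n => (m n : ℂ) * (Complex.log (1 + g n) - g n))
        =O[atTop] fun n => (m n : ℂ) * (g n) ^ 2 :=
      (Asymptotics.isBigO_refl _ _).mul hO
    have h0 : Tendsto (fun n => (m n : ℂ) * (g n) ^ 2) atTop (𝓝 0) := by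
      have := hg.mul hg0
      rw [mul_zero] at this
      refine this.congr fun n => by ring
    have h1 := (hO2.trans_tendsto h0).add hg
    rw [zero_add] at h1
    exact h1.congr fun n => by ring
  refine ((Complex.continuous_exp.tendsto _).comp hlog).congr' ?_
  have hne : ∀ᶠ n in atTop, g n ≠ -1 := hg0.eventually_ne (by simp)
  filter_upwards [hne] with n hn
  have : 1 + g n ≠ 0 := fun h => hn (by linear_combination h)
  simp only [Function.comp_apply]
  rw [Complex.exp_nat_mul, Complex.exp_log this]

theorem tendsto_mul_exp_sub_one_sub {m : ℕ → ℕ} (hm : Tendsto m atTop atTop) (x : ℝ) :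
    Tendsto (fun n => (m n : ℂ) * (Complex.exp ((x / √(m n) : ℝ) * Complex.I) - 1
      - (x / √(m n) : ℝ) * Complex.I)) atTop (𝓝 (-(x : ℂ) ^ 2 / 2)) := by
  have hs : Tendsto (fun n => x / √(m n : ℝ)) atTop (𝓝 0) :=
    tendsto_const_nhds.div_atTop
      (Real.tendsto_sqrt_atTop.comp (tendsto_natCast_atTop_atTop.comp hm))
  have hpos : ∀ᶠ n in atTop, m n ≠ 0 := hm.eventually_ne_atTop 0
  rw [tendsto_iff_norm_sub_tendsto_zero]
  have hbound : Tendsto (fun n => x ^ 2 * |x / √(m n : ℝ)| * Real.exp |x / √(m n : ℝ)|) atTop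
      (𝓝 0) := by
    have h1 : Tendsto (fun n => |x / √(m n : ℝ)|) atTop (𝓝 0) := by simpa using hs.abs
    have h2 := (h1.const_mul (x ^ 2)).mul ((Real.continuous_exp.tendsto _).comp h1)
    simpa using h2
  refine squeeze_zero' (Eventually.of_forall fun _ => norm_nonneg _) ?_ hbound
  filter_upwards [hpos] with n hn
  set z : ℂ := (x / √(m n) : ℝ) * Complex.I with hz
  have hmz : (m n : ℂ) * z ^ 2 = -(x : ℂ) ^ 2 := by
    have h1 : (m n : ℝ) * (x / √(m n)) ^ 2 = x ^ 2 := by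
      rw [div_pow, Real.sq_sqrt (by positivity)]
      field_simp
    rw [hz, mul_pow, Complex.I_sq]
    have h2 : ((m n : ℝ) * (x / √(m n)) ^ 2 : ℝ) = ((x ^ 2 : ℝ) : ℂ) := by rw [h1]
    push_cast at h2 ⊢
    linear_combination -h2
  have hnz : ‖z‖ = |x / √(m n)| := by simp [hz, abs_div]
  have h3 := Complex.norm_exp_sub_sum_le_norm_mul_exp z 3
  have hsum : ∑ i ∈ Finset.range 3, z ^ i / (i.factorial : ℂ) = 1 + z + z ^ 2 / 2 := by
    simp [Finset.sum_range_succ]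
  rw [hsum] at h3
  have heq : (m n : ℂ) * (Complex.exp z - 1 - z) - -(x : ℂ) ^ 2 / 2
      = m n * (Complex.exp z - (1 + z + z ^ 2 / 2)) := by
    rw [← hmz]; ring
  rw [heq, norm_mul, Complex.norm_natCast]
  have hmx : (m n : ℝ) * ‖z‖ ^ 2 = x ^ 2 := by
    rw [hnz, sq_abs, div_pow, Real.sq_sqrt (by positivity)]
    field_simp
  calc (m n : ℝ) * ‖Complex.exp z - (1 + z + z ^ 2 / 2)‖
      ≤ m n * (‖z‖ ^ 3 * Real.exp ‖z‖) := by gcongr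
    _ = (m n * ‖z‖ ^ 2) * ‖z‖ * Real.exp ‖z‖ := by ring
    _ = _ := by rw [hmx, hnz]

theorem charFun_map_sqrt_mul_ecdf_sub (ν : Measure ℝ) [IsProbabilityMeasure ν] (p τ : ℝ)
    {k : ℕ} (hk : k ≠ 0) (s : ℝ) :
    charFun ((Measure.pi (fun _ : Fin k => ν)).map (fun y => √(k : ℝ) * (ecdf y τ - p))) s
      = (1 + (ν.real (Set.Iic τ) * (Complex.exp ((s * (1 - p) / √k : ℝ) * Complex.I) - 1)
        + (1 - ν.real (Set.Iic τ)) * (Complex.exp ((s * (-p) / √k : ℝ) * Complex.I) - 1))) ^ k := by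
  have hmeas : Measurable (fun y : Fin k → ℝ => √(k : ℝ) * (ecdf y τ - p)) :=
    ((measurable_ecdf τ).sub_const p).const_mul _
  rw [charFun_apply_real, integral_map hmeas.aemeasurable (by fun_prop)]
  have hk0 : (0 : ℝ) < k := by positivity
  have hsq : √(k : ℝ) * √(k : ℝ) = k := Real.mul_self_sqrt hk0.le
  have hsq0 : √(k : ℝ) ≠ 0 := by positivity
  have h1 : ∀ y : Fin k → ℝ, Complex.exp (s * ((√(k : ℝ) * (ecdf y τ - p) : ℝ) : ℂ) * Complex.I)
      = ∏ i, Complex.exp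
        ((s * ((Set.Iic τ).indicator (fun _ => (1 : ℝ)) (y i) - p) / √k : ℝ) * Complex.I) := by
    intro y
    rw [← Complex.exp_sum, ← Finset.sum_mul, ← Complex.ofReal_sum, ← Complex.ofReal_mul]
    congr 3
    rw [← Finset.sum_div, ← Finset.mul_sum, Finset.sum_sub_distrib]
    simp only [Finset.sum_const, Finset.card_univ, Fintype.card_fin, nsmul_eq_mul]
    unfold ecdf
    rw [eq_div_iff hsq0]
    calc _ = s * (√(k : ℝ) * √(k : ℝ)) * ((k : ℝ)⁻¹ *
          ∑ i, (Set.Iic τ).indicator (fun _ => (1 : ℝ)) (y i) - p) := by ring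
      _ = _ := by rw [hsq]; field_simp
  simp_rw [h1]
  rw [integral_fintype_prod_eq_pow (fun x => Complex.exp
        ((s * ((Set.Iic τ).indicator (fun _ => (1 : ℝ)) x - p) / √k : ℝ) * Complex.I)),
    Fintype.card_fin]
  congr 1
  set a := Complex.exp ((s * (1 - p) / √k : ℝ) * Complex.I)
  set b := Complex.exp ((s * (-p) / √k : ℝ) * Complex.I)
  have h2 : (fun x => Complex.exp
        ((s * ((Set.Iic τ).indicator (fun _ => (1 : ℝ)) x - p) / √k : ℝ) * Complex.I))
      = fun x => b + (Set.Iic τ).indicator (fun _ => a - b) x := by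
    funext x
    by_cases hx : x ∈ Set.Iic τ
    · simp only [Set.indicator_of_mem hx, a]; ring
    · simp only [Set.indicator_of_notMem hx, b]; simp
  rw [h2, integral_add (integrable_const _) ((integrable_const _).indicator measurableSet_Iic),
    integral_indicator_const _ measurableSet_Iic]
  simp only [integral_const, probReal_univ, one_smul, Complex.real_smul]
  ring

/-- Central limit theorem for sample quantiles in a triangular array: only the behaviour of
`√m (ν (-∞, τ] - p)` matters, since the quantile is at most `τ` exactly when a binomial proportion
with success probability `ν (-∞, τ]` is at least `p`. -/
theorem tendsto_measureReal_sampleQuantile_le {p : ℝ} (hp0 : 0 < p) (hp1 : p < 1)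
    (ν : ℕ → Measure ℝ) [∀ n, IsProbabilityMeasure (ν n)] {m : ℕ → ℕ}
    (hm : Tendsto m atTop atTop) (τ : ℕ → ℝ) {b : ℝ}
    (hb : Tendsto (fun n => √(m n : ℝ) * ((ν n).real (Set.Iic (τ n)) - p)) atTop (𝓝 b)) :
    Tendsto (fun n => (Measure.pi (fun _ : Fin (m n) => ν n)).real
        {y | sampleQuantile p y ≤ τ n}) atTop
      (𝓝 ((gaussianReal b (p * (1 - p)).toNNReal).real (Set.Ici 0))) := by
  have hpos : ∀ᶠ n in atTop, m n ≠ 0 := hm.eventually_ne_atTop 0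
  have hv : 0 < p * (1 - p) := mul_pos hp0 (by linarith)
  have hmeas : ∀ n, Measurable (fun y : Fin (m n) → ℝ => √(m n : ℝ) * (ecdf y (τ n) - p)) :=
    fun n => ((measurable_ecdf _).sub_const p).const_mul _
  have hsqrt : Tendsto (fun n => √(m n : ℝ)) atTop atTop :=
    Real.tendsto_sqrt_atTop.comp (tendsto_natCast_atTop_atTop.comp hm)
  have hq : Tendsto (fun n => (ν n).real (Set.Iic (τ n))) atTop (𝓝 p) := by
    have h1 := (hb.div_atTop hsqrt).add_const p
    rw [zero_add] at h1
    refine h1.congr' ?_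
    filter_upwards [hpos] with n hn
    field_simp
    ring
  let W : ℕ → ProbabilityMeasure ℝ := fun n =>
    ⟨(Measure.pi (fun _ : Fin (m n) => ν n)).map (fun y => √(m n : ℝ) * (ecdf y (τ n) - p)),
      Measure.isProbabilityMeasure_map (hmeas n).aemeasurable⟩
  let G : ProbabilityMeasure ℝ := ⟨gaussianReal b (p * (1 - p)).toNNReal, inferInstance⟩
  have hlim : Tendsto W atTop (𝓝 G) := by
    refine ProbabilityMeasure.tendsto_of_tendsto_charFun fun s => ?_
    change Tendsto (fun n => charFun ((Measure.pi (fun _ : Fin (m n) => ν n)).map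
      (fun y => √(m n : ℝ) * (ecdf y (τ n) - p))) s) atTop
      (𝓝 (charFun (gaussianReal b (p * (1 - p)).toNNReal) s))
    rw [charFun_gaussianReal]
    have hqc : Tendsto (fun n => ((ν n).real (Set.Iic (τ n)) : ℂ)) atTop (𝓝 (p : ℂ)) :=
      (Complex.continuous_ofReal.tendsto _).comp hq
    have hbc : Tendsto (fun n => ((√(m n : ℝ) * ((ν n).real (Set.Iic (τ n)) - p) : ℝ) : ℂ)) atTop
        (𝓝 (b : ℂ)) := (Complex.continuous_ofReal.tendsto _).comp hb
    have h1 := ((hqc.mul (tendsto_mul_exp_sub_one_sub hm (s * (1 - p)))).add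
      ((hqc.const_sub 1).mul (tendsto_mul_exp_sub_one_sub hm (s * (-p))))).add
      (hbc.const_mul (s * Complex.I))
    have h2 := tendsto_one_add_pow_comp_exp hm (g := fun n =>
      ((ν n).real (Set.Iic (τ n)) * (Complex.exp ((s * (1 - p) / √(m n) : ℝ) * Complex.I) - 1)
        + (1 - (ν n).real (Set.Iic (τ n)))
          * (Complex.exp ((s * (-p) / √(m n) : ℝ) * Complex.I) - 1))) (h1.congr' ?_)
    · have h3 : (p : ℂ) * (-((s * (1 - p) : ℝ) : ℂ) ^ 2 / 2)
          + (1 - p) * (-((s * (-p) : ℝ) : ℂ) ^ 2 / 2) + s * Complex.I * b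
          = s * b * Complex.I - ((p * (1 - p)).toNNReal : ℝ) * (s : ℂ) ^ 2 / 2 := by
        rw [Real.coe_toNNReal _ hv.le]
        push_cast
        ring
      rw [h3] at h2
      refine h2.congr' ?_
      filter_upwards [hpos] with n hn
      rw [charFun_map_sqrt_mul_ecdf_sub (ν n) p (τ n) hn s]
    · filter_upwards [hpos] with n hn
      have hs0 : (√(m n : ℝ) : ℂ) ≠ 0 := by
        rw [Complex.ofReal_ne_zero]; positivity
      have hs2 : (m n : ℂ) = (√(m n : ℝ) : ℂ) * (√(m n : ℝ) : ℂ) := by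
        rw [← Complex.ofReal_mul, Real.mul_self_sqrt (by positivity)]; simp
      rw [hs2]
      push_cast
      field_simp
      ring
  have hfr : G (frontier (Set.Ici (0 : ℝ))) = 0 := by
    have : NullSingletonClass (gaussianReal b (p * (1 - p)).toNNReal) :=
      nullSingletonClass_gaussianReal (by simpa using hv)
    rw [frontier_Ici, ProbabilityMeasure.null_iff_toMeasure_null]
    exact measure_singleton (μ := gaussianReal b (p * (1 - p)).toNNReal) 0
  have hreal := (NNReal.continuous_coe.tendsto _).comp
    (ProbabilityMeasure.tendsto_measure_of_null_frontier_of_tendsto hlim hfr)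
  refine hreal.congr' ?_
  filter_upwards [hpos] with n hn
  change ((Measure.pi (fun _ : Fin (m n) => ν n)).map
    (fun y => √(m n : ℝ) * (ecdf y (τ n) - p))).real (Set.Ici 0) = _
  rw [map_measureReal_apply (hmeas n) measurableSet_Ici]
  congr 1
  ext y
  have h0 : 0 < √(m n : ℝ) := by positivity
  simp [sampleQuantile_le_iff hp0 hp1.le hn, mul_nonneg_iff_of_pos_left h0]

theorem gaussianReal_Iic_eq {f0 : ℝ} (hf0 : 0 < f0) {v : ℝ} (hv : 0 ≤ v) (t : ℝ) :
    (gaussianReal (f0 * t) v.toNNReal).real (Set.Ici 0)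
      = (gaussianReal 0 (v / f0 ^ 2).toNNReal).real (Set.Iic t) := by
  have h : (gaussianReal 0 (v / f0 ^ 2).toNNReal).map (fun x => f0 * (t - x))
      = gaussianReal (f0 * t) v.toNNReal := by
    have : (fun x => f0 * (t - x)) = (fun x => f0 * x) ∘ (fun x => t - x) := rfl
    rw [this, ← Measure.map_map (by fun_prop) (by fun_prop), gaussianReal_map_const_sub,
      gaussianReal_map_const_mul]
    congr 1
    · ring
    · ext
      simp only [NNReal.coe_mul, NNReal.coe_mk]
      rw [Real.coe_toNNReal _ hv, Real.coe_toNNReal _ (by positivity)]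
      field_simp
  rw [← h, map_measureReal_apply (by fun_prop) measurableSet_Ici]
  congr 1
  ext x
  simp [mul_nonneg_iff_of_pos_left hf0]

/-! ### Tail bounds for sample quantiles -/

theorem le_ecdf_iff {k : ℕ} (hk : k ≠ 0) (p t : ℝ) (y : Fin k → ℝ) :
    p ≤ ecdf y t ↔ k * p ≤ ∑ i, (Set.Iic t).indicator (fun _ => (1 : ℝ)) (y i) := by
  unfold ecdf
  rw [inv_mul_eq_div, le_div_iff₀ (by positivity), mul_comm]

theorem setOf_lt_abs_sampleQuantile_subset {p : ℝ} (hp0 : 0 < p) (hp1 : p < 1) {k : ℕ}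
    (hk : k ≠ 0) (c t : ℝ) :
    {y : Fin k → ℝ | t < |√(k : ℝ) * (sampleQuantile p y - c)|}
      ⊆ {y | ∑ i, (Set.Iic (c + t / √k)).indicator (fun _ => (1 : ℝ)) (y i) < k * p}
        ∪ {y | k * p ≤ ∑ i, (Set.Iic (c - t / √k)).indicator (fun _ => (1 : ℝ)) (y i)} := by
  have hs : 0 < √(k : ℝ) := by positivity
  intro y hy
  rw [Set.mem_ofPred_eq, lt_abs] at hy
  rcases hy with h | h
  · left
    rw [Set.mem_ofPred_eq, ← not_le, ← le_ecdf_iff hk, ← sampleQuantile_le_iff hp0 hp1.le hk,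
      not_le]
    have := (div_lt_iff₀' hs).2 h
    linarith
  · right
    rw [Set.mem_ofPred_eq, ← le_ecdf_iff hk, ← sampleQuantile_le_iff hp0 hp1.le hk]
    have : t / √k < c - sampleQuantile p y := by
      rw [div_lt_iff₀' hs]; linarith
    linarith

theorem measureReal_lt_abs_sampleQuantile_le {p : ℝ} (hp0 : 0 < p) (hp1 : p < 1) {k : ℕ}
    (hk : k ≠ 0) (ν : Measure ℝ) [IsProbabilityMeasure ν] (c t : ℝ) {r : ℝ} (hr : 0 ≤ r)
    (hup : p + r ≤ ν.real (Set.Iic (c + t / √k))) (hlo : ν.real (Set.Iic (c - t / √k)) ≤ p - r) :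
    (Measure.pi (fun _ : Fin k => ν)).real {y | t < |√(k : ℝ) * (sampleQuantile p y - c)|}
      ≤ 2 * Real.exp (-(k * r ^ 2 / 4)) := by
  have hr2 : r ≤ 2 := by
    have : ν.real (Set.Iic (c + t / √k)) ≤ 1 := measureReal_le_one
    linarith
  have h1 := measureReal_sum_indicator_le_le ν (measurableSet_Iic (a := c + t / √k)) k hr hr2
  have h2 := measureReal_sum_indicator_ge_le ν (measurableSet_Iic (a := c - t / √k)) k hr hr2
  refine (measureReal_mono (setOf_lt_abs_sampleQuantile_subset hp0 hp1 hk c t)).trans ?_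
  refine (measureReal_union_le _ _).trans ?_
  rw [two_mul]
  refine add_le_add ((measureReal_mono ?_).trans h1) ((measureReal_mono ?_).trans h2)
  · intro y hy
    simp only [Set.mem_ofPred_eq] at hy ⊢
    exact hy.le.trans (by gcongr; linarith)
  · intro y hy
    simp only [Set.mem_ofPred_eq] at hy ⊢
    exact le_trans (by gcongr; linarith) hy

/-- Far from its centre, the sample quantile can only lie if a fixed fraction of the sample is far
from the origin. -/
theorem setOf_lt_abs_sampleQuantile_subset_far {p : ℝ} (hp0 : 0 < p) (hp1 : p < 1) {k : ℕ}
    (hk : k ≠ 0) {c t : ℝ} (hc : 2 * |c| ≤ t / √k) :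
    {y : Fin k → ℝ | t < |√(k : ℝ) * (sampleQuantile p y - c)|}
      ⊆ {y | k * min p (1 - p) ≤
          ∑ i, {x : ℝ | t / √k / 2 ≤ |x|}.indicator (fun _ => (1 : ℝ)) (y i)} := by
  refine (setOf_lt_abs_sampleQuantile_subset hp0 hp1 hk c t).trans ?_
  have hc1 := le_abs_self c
  have hc2 := neg_abs_le c
  rintro y (hy | hy)
  · simp only [Set.mem_ofPred_eq] at hy ⊢
    have h1 : ∑ i, (1 - (Set.Iic (c + t / √k)).indicator (fun _ => (1 : ℝ)) (y i))
        ≤ ∑ i, {x : ℝ | t / √k / 2 ≤ |x|}.indicator (fun _ => (1 : ℝ)) (y i) := by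
      refine Finset.sum_le_sum fun i _ => ?_
      by_cases hi : y i ≤ c + t / √k
      · rw [Set.indicator_of_mem (s := Set.Iic _) hi, sub_self]
        exact Set.indicator_nonneg (fun _ _ => zero_le_one) _
      · rw [Set.indicator_of_notMem (s := Set.Iic _) hi, Set.indicator_of_mem]
        · simp
        · rw [Set.mem_ofPred_eq]
          exact le_trans (by linarith) (le_abs_self (y i))
    rw [Finset.sum_sub_distrib] at h1
    simp only [Finset.sum_const, Finset.card_univ, Fintype.card_fin, nsmul_eq_mul, mul_one] at h1
    have h2 : (k : ℝ) * min p (1 - p) ≤ k * (1 - p) := by gcongr; exact min_le_right _ _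
    linarith
  · simp only [Set.mem_ofPred_eq] at hy ⊢
    have h2 : (k : ℝ) * min p (1 - p) ≤ k * p := by gcongr; exact min_le_left _ _
    refine h2.trans (hy.trans (Finset.sum_le_sum fun i _ => ?_))
    by_cases hi : y i ≤ c - t / √k
    · rw [Set.indicator_of_mem (s := Set.Iic _) hi, Set.indicator_of_mem]
      rw [Set.mem_ofPred_eq]
      exact le_trans (by linarith) (neg_le_abs (y i))
    · rw [Set.indicator_of_notMem (s := Set.Iic _) hi]
      exact Set.indicator_nonneg (fun _ _ => zero_le_one) _

theorem measureReal_le_abs_le {ν : Measure ℝ} [IsProbabilityMeasure ν] {α M : ℝ} (hα : 0 < α)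
    (hint : Integrable (fun x : ℝ => |x| ^ α) ν) (hM : ∫ x, |x| ^ α ∂ν ≤ M) {u : ℝ} (hu : 0 < u) :
    ν.real {x | u ≤ |x|} ≤ M * u ^ (-α) := by
  have h := mul_meas_ge_le_integral_of_nonneg
    (ae_of_all ν fun x : ℝ => Real.rpow_nonneg (abs_nonneg x) α) hint (u ^ α)
  have hset : {x : ℝ | u ^ α ≤ |x| ^ α} = {x | u ≤ |x|} := by
    ext x
    simp only [Set.mem_ofPred_eq]
    exact Real.rpow_le_rpow_iff hu.le (abs_nonneg x) hα
  rw [hset] at h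
  rw [Real.rpow_neg hu.le, ← div_eq_mul_inv, le_div_iff₀ (by positivity), mul_comm]
  exact h.trans hM

theorem exp_neg_le_two_div_sq {x : ℝ} (hx : 0 < x) : Real.exp (-x) ≤ 2 / x ^ 2 := by
  have h := Real.quadratic_le_exp_of_nonneg hx.le
  rw [Real.exp_neg, inv_eq_one_div, div_le_div_iff₀ (Real.exp_pos x) (by positivity)]
  nlinarith

/-- Beyond a fixed distance `T`, the fraction-of-outliers bound makes the tail of the rescaled
sample quantile at most `t ^ (-4)`, however small the moment exponent `α`: the exponent of the
tail grows linearly in the sample size. -/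
theorem exists_far_tail_bound {p : ℝ} (hp0 : 0 < p) (hp1 : p < 1) {α : ℝ} (hα : 0 < α) (B M : ℝ) :
    ∃ T : ℝ, 0 < T ∧ ∃ k₀ : ℕ, ∀ k ≥ k₀, ∀ (ν : Measure ℝ) [IsProbabilityMeasure ν], ∀ c : ℝ,
      |c| ≤ B → Integrable (fun x : ℝ => |x| ^ α) ν → ∫ x, |x| ^ α ∂ν ≤ M →
      ∀ t : ℝ, T ≤ t / √k →
      (Measure.pi (fun _ : Fin k => ν)).real {y | t < |√(k : ℝ) * (sampleQuantile p y - c)|}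
        ≤ 1 / t ^ 4 := by
  set r := min p (1 - p) with hr
  have hr0 : 0 < r := lt_min hp0 (by linarith)
  set M' := max M 1 with hM'
  have hM'0 : 0 < M' := lt_of_lt_of_le one_pos (le_max_right _ _)
  have hlim1 : Tendsto (fun u : ℝ => M' * (u / 2) ^ (-α)) atTop (𝓝 0) := by
    have h1 : Tendsto (fun u : ℝ => u / 2) atTop atTop := tendsto_id.atTop_div_const (by norm_num)
    simpa using ((tendsto_rpow_neg_atTop hα).comp h1).const_mul M'
  have hlim2 : Tendsto (fun u : ℝ => 2 * (M' * (u / 2) ^ (-α)) ^ (r / 2)) atTop (𝓝 0) := by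
    have h2 := hlim1.rpow_const (p := r / 2) (Or.inr (by positivity))
    rw [Real.zero_rpow (by positivity)] at h2
    simpa using h2.const_mul 2
  have hlim3 : Tendsto (fun u : ℝ => M' * 2 ^ α * u ^ (-(α / 2))) atTop (𝓝 0) := by
    simpa using (tendsto_rpow_neg_atTop (half_pos hα)).const_mul (M' * 2 ^ α)
  obtain ⟨T, hT⟩ := eventually_atTop.1
    (((hlim1.eventually_le_const zero_lt_one).and
      (hlim2.eventually_le_const (show (0 : ℝ) < 1 / 4 by norm_num))).and
      ((hlim3.eventually_le_const zero_lt_one).and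
      ((eventually_ge_atTop 1).and (eventually_ge_atTop (2 * B)))))
  obtain ⟨k₀, hk₀⟩ := exists_nat_ge (16 / (α * r))
  refine ⟨max T 1, lt_of_lt_of_le one_pos (le_max_right _ _), k₀ + 1, ?_⟩
  intro k hk ν _ c hc hint hMint t ht
  have hk0 : k ≠ 0 := by omega
  set u := t / √(k : ℝ) with hu
  obtain ⟨⟨hq1, hq2⟩, hq3, hu1, huB⟩ := hT u ((le_max_left _ _).trans ht)
  have hu0 : 0 < u := by linarith
  set q := M' * (u / 2) ^ (-α) with hq
  have hq0 : 0 < q := by positivity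
  have hνq : ν.real {x | u / 2 ≤ |x|} ≤ q :=
    measureReal_le_abs_le hα hint (hMint.trans (le_max_left _ _)) (half_pos hu0)
  have hAmeas : MeasurableSet {x : ℝ | u / 2 ≤ |x|} :=
    measurableSet_le measurable_const measurable_norm
  have hP := (measureReal_mono (setOf_lt_abs_sampleQuantile_subset_far hp0 hp1 hk0
    (c := c) (t := t) (by linarith))).trans
    (measureReal_sum_indicator_ge_le_rpow ν hAmeas k r hq0 hq1 hνq)
  refine hP.trans ?_
  -- half of the exponent `r` beats the factor `2 ^ k`, the other half gives the power of `u`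
  have hqu : q ≤ u ^ (-(α / 2)) := by
    have h1 : q = (M' * 2 ^ α * u ^ (-(α / 2))) * u ^ (-(α / 2)) := by
      rw [hq, Real.div_rpow hu0.le (by norm_num), mul_assoc _ (u ^ _), ← Real.rpow_add hu0,
        Real.rpow_neg (by norm_num : (0 : ℝ) ≤ 2)]
      have : -(α / 2) + -(α / 2) = -α := by ring
      rw [this]
      field_simp
    rw [h1]
    have : 0 ≤ u ^ (-(α / 2)) := by positivity
    nlinarith
  have h2 : 2 * q ^ r ≤ 1 / 4 * u ^ (-(α * r / 4)) := by
    have h3 : q ^ r = q ^ (r / 2) * q ^ (r / 2) := by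
      rw [← Real.rpow_add hq0]; ring_nf
    have h4 : q ^ (r / 2) ≤ u ^ (-(α * r / 4)) := by
      calc q ^ (r / 2) ≤ (u ^ (-(α / 2))) ^ (r / 2) := by gcongr
        _ = u ^ (-(α * r / 4)) := by rw [← Real.rpow_mul hu0.le]; ring_nf
    rw [h3, ← mul_assoc]
    gcongr
  have h5 : (u ^ (-(α * r / 4))) ^ k ≤ u ^ (-4 : ℝ) := by
    rw [← Real.rpow_mul_natCast hu0.le]
    apply Real.rpow_le_rpow_of_exponent_le hu1
    have h6 : 16 / (α * r) ≤ (k : ℝ) := hk₀.trans (by exact_mod_cast (by omega : k₀ ≤ k))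
    rw [div_le_iff₀ (by positivity)] at h6
    linarith
  have h7 : ((1 : ℝ) / 4) ^ k ≤ 1 / (k : ℝ) ^ 2 := by
    have h8 : (k : ℝ) ≤ 2 ^ k := by exact_mod_cast (Nat.lt_two_pow_self (n := k)).le
    rw [div_pow, one_pow]
    apply one_div_le_one_div_of_le (by positivity)
    calc (k : ℝ) ^ 2 ≤ (2 ^ k) ^ 2 := by gcongr
      _ = 4 ^ k := by rw [← pow_mul, mul_comm, pow_mul]; norm_num
  calc (2 * q ^ r) ^ k ≤ (1 / 4 * u ^ (-(α * r / 4))) ^ k := by gcongr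
    _ = (1 / 4) ^ k * (u ^ (-(α * r / 4))) ^ k := mul_pow _ _ _
    _ ≤ 1 / (k : ℝ) ^ 2 * u ^ (-4 : ℝ) := by gcongr
    _ = 1 / t ^ 4 := by
      have ht4 : t ^ 4 = (k : ℝ) ^ 2 * u ^ 4 := by
        have : t = √(k : ℝ) * u := by rw [hu]; field_simp
        rw [this, mul_pow]
        congr 1
        calc √(k : ℝ) ^ 4 = (√(k : ℝ) ^ 2) ^ 2 := by ring
          _ = _ := by rw [Real.sq_sqrt (by positivity)]
      rw [ht4, Real.rpow_neg hu0.le]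
      norm_cast
      field_simp

/-- A tail bound for the rescaled sample quantile that is uniform over the sample size and over all
laws whose distribution function is close to `u ↦ p + f₀ u` on a neighborhood of `c` of fixed size,
and whose moment of order `α` is bounded. Any exponent above `2` in place of `4` would do for
the convergence of second moments. -/
theorem exists_tail_bound {p : ℝ} (hp0 : 0 < p) (hp1 : p < 1) {α f₀ δ : ℝ} (hα : 0 < α)
    (hf₀ : 0 < f₀) (hδ : 0 < δ) (B M : ℝ) :
    ∃ K : ℝ, ∃ k₀ : ℕ, ∀ k ≥ k₀, ∀ (ν : Measure ℝ) [IsProbabilityMeasure ν], ∀ c : ℝ,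
      |c| ≤ B → Integrable (fun x : ℝ => |x| ^ α) ν → ∫ x, |x| ^ α ∂ν ≤ M →
      (∀ u, |u| ≤ δ →
        |ν.real (Set.Iic (c + u)) - p - f₀ * u| ≤ f₀ / 4 * (|u| + 1 / √(k : ℝ))) →
      ∀ t : ℝ, 1 ≤ t →
      (Measure.pi (fun _ : Fin k => ν)).real {y | t < |√(k : ℝ) * (sampleQuantile p y - c)|}
        ≤ K / t ^ 4 := by
  obtain ⟨T₀, hT₀, k₀, hfar⟩ := exists_far_tail_bound hp0 hp1 hα B M
  set T := max T₀ δ with hT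
  have hT0 : 0 < T := lt_of_lt_of_le hδ (le_max_right _ _)
  obtain ⟨k₁, hk₁⟩ := exists_nat_ge (1 / δ ^ 2)
  set κ := f₀ * δ / (2 * T) with hκ
  have hκ0 : 0 < κ := by positivity
  refine ⟨max 1 (64 / κ ^ 4), max (k₀ + 1) (k₁ + 1), ?_⟩
  intro k hk ν _ c hc hint hM hloc t ht
  have hkk₀ : k₀ ≤ k := by have := le_max_left (k₀ + 1) (k₁ + 1); omega
  have hkk₁ : k₁ ≤ k := by have := le_max_right (k₀ + 1) (k₁ + 1); omega
  have hk0 : k ≠ 0 := by have := le_max_left (k₀ + 1) (k₁ + 1); omega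
  have hs0 : 0 < √(k : ℝ) := by positivity
  have ht0 : 0 < t := by linarith
  rcases le_or_gt T (t / √k) with h | h
  · refine (hfar k hkk₀ ν c hc hint hM t ((le_max_left _ _).trans h)).trans ?_
    gcongr
    exact le_max_left _ _
  · set u := t / √(k : ℝ) with hu
    have hu0 : 0 < u := by positivity
    have hku : 1 / √(k : ℝ) ≤ u := by rw [hu]; gcongr
    have hkδ : 1 / √(k : ℝ) ≤ δ := by
      rw [div_le_iff₀ hs0]
      have h1 : (k₁ : ℝ) ≤ k := by exact_mod_cast hkk₁
      have h2 : 1 / δ ^ 2 ≤ (√(k : ℝ)) ^ 2 := by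
        rw [Real.sq_sqrt (by positivity)]; linarith
      rw [div_le_iff₀ (by positivity), ← mul_pow] at h2
      have h3 : 0 < √(k : ℝ) * δ := by positivity
      nlinarith
    have hloc' : ∀ v, 0 ≤ v → v ≤ δ → 1 / √(k : ℝ) ≤ v →
        p + f₀ * v / 2 ≤ ν.real (Set.Iic (c + v)) ∧ ν.real (Set.Iic (c - v)) ≤ p - f₀ * v / 2 := by
      intro v hv0 hvδ hkv
      have ha := hloc v (by rwa [abs_of_nonneg hv0])
      have hb := hloc (-v) (by rwa [abs_neg, abs_of_nonneg hv0])
      rw [abs_neg] at hb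
      rw [abs_of_nonneg hv0] at ha hb
      have hc : f₀ / 4 * (v + 1 / √(k : ℝ)) ≤ f₀ / 4 * (v + v) := by gcongr
      have ha' := (abs_le.1 ha).1
      have hb' := (abs_le.1 hb).2
      rw [← sub_eq_add_neg] at hb'
      constructor <;> linarith
    have hr : p + κ * u ≤ ν.real (Set.Iic (c + u)) ∧ ν.real (Set.Iic (c - u)) ≤ p - κ * u := by
      rcases le_or_gt u δ with huδ | huδ
      · have h1 := hloc' u hu0.le huδ hku
        have h2 : κ * u ≤ f₀ * u / 2 := by
          have : κ ≤ f₀ / 2 := by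
            rw [hκ, div_le_div_iff₀ (by positivity) (by norm_num)]
            have : δ ≤ T := le_max_right _ _
            nlinarith
          nlinarith
        exact ⟨by linarith [h1.1], by linarith [h1.2]⟩
      · have h1 := hloc' δ hδ.le le_rfl hkδ
        have h2 : κ * u ≤ f₀ * δ / 2 := by
          calc κ * u ≤ κ * T := by gcongr
            _ = f₀ * δ / 2 := by rw [hκ]; field_simp
        have h3 : ν.real (Set.Iic (c + δ)) ≤ ν.real (Set.Iic (c + u)) :=
          measureReal_mono (Set.Iic_subset_Iic.2 (by linarith))
        have h4 : ν.real (Set.Iic (c - u)) ≤ ν.real (Set.Iic (c - δ)) :=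
          measureReal_mono (Set.Iic_subset_Iic.2 (by linarith))
        exact ⟨by linarith [h1.1], by linarith [h1.2]⟩
    refine (measureReal_lt_abs_sampleQuantile_le hp0 hp1 hk0 ν c t (r := κ * u) (by positivity)
      hr.1 hr.2).trans ?_
    have hkr : (k : ℝ) * (κ * u) ^ 2 / 4 = κ ^ 2 * t ^ 2 / 4 := by
      rw [hu, mul_pow κ, div_pow t, Real.sq_sqrt (by positivity)]
      field_simp
    rw [hkr]
    calc 2 * Real.exp (-(κ ^ 2 * t ^ 2 / 4)) ≤ 2 * (2 / (κ ^ 2 * t ^ 2 / 4) ^ 2) := by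
          gcongr; exact exp_neg_le_two_div_sq (by positivity)
      _ = (64 / κ ^ 4) / t ^ 4 := by field_simp; norm_num
      _ ≤ max 1 (64 / κ ^ 4) / t ^ 4 := by gcongr; exact le_max_right _ _

/-! ### Convergence of variances in triangular arrays -/

/-- Pointwise convergence of distribution functions, at all points, implies weak convergence. -/
theorem tendsto_probabilityMeasure_of_tendsto_Iic {ρ : ℕ → ProbabilityMeasure ℝ}
    {ρ₀ : ProbabilityMeasure ℝ}
    (h : ∀ t : ℝ, Tendsto (fun n => (ρ n : Measure ℝ).real (Set.Iic t)) atTop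
      (𝓝 ((ρ₀ : Measure ℝ).real (Set.Iic t)))) :
    Tendsto ρ atTop (𝓝 ρ₀) := by
  refine (isPiSystem_Ioc (id : ℝ → ℝ) id).tendsto_probabilityMeasure_of_tendsto_of_mem
    ?_ ?_ ?_
  · rintro s ⟨a, b, -, rfl⟩
    exact measurableSet_Ioc
  · intro u hu x hx
    obtain ⟨ε, hε, hsub⟩ := Metric.isOpen_iff.1 hu x hx
    refine ⟨Set.Ioc (x - ε / 2) (x + ε / 2), ⟨x - ε / 2, x + ε / 2, ?_, rfl⟩,
      Ioc_mem_nhds (by linarith) (by linarith), fun y hy => hsub ?_⟩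
    · simp only [id]; linarith
    · rw [Metric.mem_ball, Real.dist_eq, abs_lt]
      constructor <;> linarith [hy.1, hy.2]
  · rintro s ⟨a, b, hab, rfl⟩
    rw [← NNReal.tendsto_coe]
    simp only [id] at hab ⊢
    have key : ∀ π : ProbabilityMeasure ℝ, ((π (Set.Ioc a b) : NNReal) : ℝ)
        = (π : Measure ℝ).real (Set.Iic b) - (π : Measure ℝ).real (Set.Iic a) := by
      intro π
      change (π : Measure ℝ).real (Set.Ioc a b) = _
      rw [← Set.Iic_sdiff_Iic, measureReal_sdiff (Set.Iic_subset_Iic.2 hab.le) measurableSet_Iic]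
    simp_rw [key]
    exact (h b).sub (h a)

/-- Under weak convergence and a uniform tail bound of order `t ^ (-4)`, the second moments about
any point within distance `1` of the origin converge, by the layer cake formula. -/
theorem tendsto_integral_add_sq {ρ : ℕ → ProbabilityMeasure ℝ} {ρ₀ : ProbabilityMeasure ℝ}
    (h : Tendsto ρ atTop (𝓝 ρ₀)) [NullSingletonClass (ρ₀ : Measure ℝ)]
    (hint₀ : ∀ a : ℝ, Integrable (fun x => (x + a) ^ 2) (ρ₀ : Measure ℝ)) {K : ℝ}
    (htail : ∀ᶠ n in atTop, ∀ t : ℝ, 1 ≤ t → (ρ n : Measure ℝ).real {x | t < |x|} ≤ K / t ^ 4)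
    {a : ℝ} (ha : |a| ≤ 1) :
    (∀ᶠ n in atTop, Integrable (fun x => (x + a) ^ 2) (ρ n : Measure ℝ)) ∧
    Tendsto (fun n => ∫ x, (x + a) ^ 2 ∂(ρ n : Measure ℝ)) atTop
      (𝓝 (∫ x, (x + a) ^ 2 ∂(ρ₀ : Measure ℝ))) := by
  set g : ℝ → ℝ := fun s => if s ≤ 4 then 1 else 16 * K * s ^ (-2 : ℝ) with hg
  have hgint : IntegrableOn g (Set.Ioi 0) := by
    rw [← Set.Ioc_union_Ioi_eq_Ioi (show (0 : ℝ) ≤ 4 by norm_num)]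
    refine IntegrableOn.union ?_ ?_
    · have h1 : IntegrableOn (fun _ : ℝ => (1 : ℝ)) (Set.Ioc 0 4) :=
        integrableOn_const (by simp)
      exact h1.congr_fun (fun s hs => by simp [hg, hs.2]) measurableSet_Ioc
    · have h1 : IntegrableOn (fun s : ℝ => 16 * K * s ^ (-2 : ℝ)) (Set.Ioi 4) :=
        (integrableOn_Ioi_rpow_of_lt (by norm_num) (by norm_num)).const_mul _
      exact h1.congr_fun (fun s hs => by simp [hg, not_le.2 (Set.mem_Ioi.1 hs)]) measurableSet_Ioi
  have hbound : ∀ᶠ n in atTop, ∀ s : ℝ, 0 < s →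
      (ρ n : Measure ℝ).real {x | s < (x + a) ^ 2} ≤ g s := by
    filter_upwards [htail] with n hn s hs
    by_cases hs4 : s ≤ 4
    · simp only [hg, hs4, if_true]
      exact measureReal_le_one
    · simp only [hg, hs4, if_false]
      push Not at hs4
      have h2 : 2 < √s := by
        rw [Real.lt_sqrt (by norm_num)]; linarith
      have h3 := hn (√s / 2) (by linarith)
      refine (measureReal_mono ?_).trans (h3.trans_eq ?_)
      · intro x hx
        rw [Set.mem_ofPred_eq] at hx ⊢
        have h4 : √s < |x + a| := by
          rw [← Real.sqrt_sq_eq_abs]; exact Real.sqrt_lt_sqrt hs.le hx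
        have h5 := abs_add_le x a
        linarith
      · have h6 : √s ^ 4 = s ^ 2 := by
          calc √s ^ 4 = (√s ^ 2) ^ 2 := by ring
            _ = _ := by rw [Real.sq_sqrt hs.le]
        rw [div_pow, h6, Real.rpow_neg hs.le]
        norm_cast
        field_simp
        norm_num
  have hintn : ∀ᶠ n in atTop, Integrable (fun x => (x + a) ^ 2) (ρ n : Measure ℝ) := by
    filter_upwards [hbound] with n hn
    rw [← lintegral_ofReal_ne_top_iff_integrable (by fun_prop)
      (ae_of_all _ fun x => sq_nonneg _),
      lintegral_eq_lintegral_meas_lt _ (ae_of_all _ fun x => sq_nonneg _) (by fun_prop)]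
    refine ne_top_of_le_ne_top hgint.lintegral_lt_top.ne ?_
    refine setLIntegral_mono' measurableSet_Ioi fun s hs => ?_
    rw [← ofReal_measureReal]
    exact ENNReal.ofReal_le_ofReal (hn s hs)
  refine ⟨hintn, ?_⟩
  rw [(hint₀ a).integral_eq_integral_meas_lt (ae_of_all _ fun x => sq_nonneg _)]
  have hlim : Tendsto (fun n => ∫ s in Set.Ioi (0 : ℝ),
      (ρ n : Measure ℝ).real {x | s < (x + a) ^ 2}) atTop
      (𝓝 (∫ s in Set.Ioi (0 : ℝ), (ρ₀ : Measure ℝ).real {x | s < (x + a) ^ 2})) := by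
    refine tendsto_integral_filter_of_dominated_convergence g ?_ ?_ hgint ?_
    · refine Eventually.of_forall fun n => ?_
      have : Antitone fun s : ℝ => (ρ n : Measure ℝ).real {x | s < (x + a) ^ 2} :=
        fun s t hst => measureReal_mono fun x hx => lt_of_le_of_lt hst hx
      exact this.measurable.aestronglyMeasurable
    · filter_upwards [hbound] with n hn
      filter_upwards [ae_restrict_mem measurableSet_Ioi] with s hs
      rw [Real.norm_of_nonneg measureReal_nonneg]
      exact hn s hs
    · filter_upwards [ae_restrict_mem measurableSet_Ioi] with s hs
      have hfr : ρ₀ (frontier {x : ℝ | s < (x + a) ^ 2}) = 0 := by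
        rw [ProbabilityMeasure.null_iff_toMeasure_null]
        refine measure_mono_null (frontier_lt_subset_eq (by fun_prop) (by fun_prop)) ?_
        refine measure_mono_null (t := {√s - a, -√s - a}) ?_
          ((Set.toFinite _).countable.measure_zero _)
        intro x hx
        rw [Set.mem_ofPred_eq] at hx
        have h7 : √s = |x + a| := by rw [hx, Real.sqrt_sq_eq_abs]
        rw [Set.mem_insert_iff, Set.mem_singleton_iff, h7]
        rcases abs_cases (x + a) with h8 | h8
        · left; linarith
        · right; linarith
      exact (NNReal.continuous_coe.tendsto _).comp
        (ProbabilityMeasure.tendsto_measure_of_null_frontier_of_tendsto h hfr)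
  refine hlim.congr' ?_
  filter_upwards [hintn] with n hn
  rw [hn.integral_eq_integral_meas_lt (ae_of_all _ fun x => sq_nonneg _)]

theorem tendsto_variance_of_tail_bound {ρ : ℕ → ProbabilityMeasure ℝ} {ρ₀ : ProbabilityMeasure ℝ}
    (h : Tendsto ρ atTop (𝓝 ρ₀)) [NullSingletonClass (ρ₀ : Measure ℝ)]
    (hint₀ : MemLp id 2 (ρ₀ : Measure ℝ)) {K : ℝ}
    (htail : ∀ᶠ n in atTop, ∀ t : ℝ, 1 ≤ t → (ρ n : Measure ℝ).real {x | t < |x|} ≤ K / t ^ 4) :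
    Tendsto (fun n => Var[id; (ρ n : Measure ℝ)]) atTop (𝓝 Var[id; (ρ₀ : Measure ℝ)]) := by
  -- with `S a = ∫ (x + a) ^ 2`, the mean is `(S 1 - S 0 - 1) / 2`
  have hvar : ∀ π : ProbabilityMeasure ℝ, Integrable (fun x => (x + 0) ^ 2) (π : Measure ℝ) →
      Var[id; (π : Measure ℝ)] = (∫ x, (x + 0) ^ 2 ∂(π : Measure ℝ))
        - ((∫ x, (x + 1) ^ 2 ∂(π : Measure ℝ) - ∫ x, (x + 0) ^ 2 ∂(π : Measure ℝ) - 1) / 2) ^ 2 :=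
      by
    intro π hπ
    have hL2 : MemLp id 2 (π : Measure ℝ) :=
      (memLp_two_iff_integrable_sq (by fun_prop)).2 (by simpa using hπ)
    have hL1 : Integrable (fun x : ℝ => x) (π : Measure ℝ) := hL2.integrable one_le_two
    have h1 : ∫ x, (x + 1) ^ 2 ∂(π : Measure ℝ)
        = ∫ x, (x + 0) ^ 2 ∂(π : Measure ℝ) + 2 * ∫ x, x ∂(π : Measure ℝ) + 1 := by
      have h2 : (fun x : ℝ => (x + 1) ^ 2) = fun x => ((x + 0) ^ 2 + 2 * x) + 1 := by
        funext x; ring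
      have h3 : Integrable (fun x : ℝ => (x + 0) ^ 2 + 2 * x) (π : Measure ℝ) :=
        hπ.add (hL1.const_mul 2)
      rw [h2, integral_add h3 (integrable_const _), integral_add hπ (hL1.const_mul 2),
        integral_const_mul]
      simp
    rw [variance_eq_sub hL2, h1]
    simp only [Pi.pow_apply, id, add_zero]
    ring
  have hint₀' : ∀ a : ℝ, Integrable (fun x => (x + a) ^ 2) (ρ₀ : Measure ℝ) := fun a =>
    (hint₀.add (memLp_const a)).integrable_sq
  have h0 := tendsto_integral_add_sq h hint₀' htail (a := 0) (by simp)
  have h1 := tendsto_integral_add_sq h hint₀' htail (a := 1) (by simp)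
  rw [hvar ρ₀ (hint₀' 0)]
  refine (h0.2.sub ((((h1.2.sub h0.2).sub_const 1).div_const 2).pow 2)).congr' ?_
  filter_upwards [h0.1] with n hn
  rw [hvar (ρ n) hn]

/-- Quantile asymptotics for a triangular array of laws `ν n` whose distribution functions are
asymptotically linear with slope `f₀` around `c n`, up to an error that is small compared with
`|u| + 1 / √(m n)`: the rescaled sample quantile of a sample of size `m n` has asymptotic
distribution function that of `N(0, p (1 - p) / f₀ ^ 2)`. -/
theorem tendsto_measureReal_sqrt_mul_sampleQuantile_sub_le {p : ℝ} (hp0 : 0 < p) (hp1 : p < 1)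
    (ν : ℕ → Measure ℝ) [∀ n, IsProbabilityMeasure (ν n)] {m : ℕ → ℕ}
    (hm : Tendsto m atTop atTop) (c : ℕ → ℝ) {f₀ : ℝ} (hf₀ : 0 < f₀)
    (hloc : ∀ ε > 0, ∃ δ > 0, ∀ᶠ n in atTop, ∀ u, |u| ≤ δ →
      |(ν n).real (Set.Iic (c n + u)) - p - f₀ * u| ≤ ε * (|u| + 1 / √(m n : ℝ)))
    {t : ℕ → ℝ} {t₀ : ℝ} (ht : Tendsto t atTop (𝓝 t₀)) :
    Tendsto (fun n => (Measure.pi (fun _ : Fin (m n) => ν n)).real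
        {y | √(m n : ℝ) * (sampleQuantile p y - c n) ≤ t n}) atTop
      (𝓝 ((gaussianReal 0 (p * (1 - p) / f₀ ^ 2).toNNReal).real (Set.Iic t₀))) := by
  have hpos : ∀ᶠ n in atTop, m n ≠ 0 := hm.eventually_ne_atTop 0
  have hsqrt : Tendsto (fun n => √(m n : ℝ)) atTop atTop :=
    Real.tendsto_sqrt_atTop.comp (tendsto_natCast_atTop_atTop.comp hm)
  have hu : Tendsto (fun n => t n / √(m n : ℝ)) atTop (𝓝 0) := ht.div_atTop hsqrt
  have hb : Tendsto (fun n => √(m n : ℝ) * ((ν n).real (Set.Iic (c n + t n / √(m n : ℝ))) - p))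
      atTop (𝓝 (f₀ * t₀)) := by
    have hsub : Tendsto (fun n => √(m n : ℝ) * ((ν n).real (Set.Iic (c n + t n / √(m n : ℝ))) - p)
        - f₀ * t n) atTop (𝓝 0) := by
      rw [Metric.tendsto_atTop']
      intro ε hε
      obtain ⟨δ, hδ, hev⟩ := hloc (ε / (2 * (|t₀| + 2))) (by positivity)
      have hsmall : ∀ᶠ n in atTop, |t n / √(m n : ℝ)| ≤ δ := by
        have := hu.abs
        rw [abs_zero] at this
        exact this.eventually_le_const hδ
      have htb : ∀ᶠ n in atTop, |t n| ≤ |t₀| + 1 :=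
        ht.abs.eventually_le_const (by linarith)
      refine eventually_atTop.1 ?_ |>.imp fun N hN n hn => hN n hn.le
      filter_upwards [hev, hsmall, htb, hpos] with n h1 h2 h3 h4
      have hs : 0 < √(m n : ℝ) := by positivity
      have h5 := h1 _ h2
      rw [Real.dist_eq, sub_zero]
      have h6 : √(m n : ℝ) * ((ν n).real (Set.Iic (c n + t n / √(m n : ℝ))) - p) - f₀ * t n
          = √(m n : ℝ) * ((ν n).real (Set.Iic (c n + t n / √(m n : ℝ))) - p
            - f₀ * (t n / √(m n : ℝ))) := by
        field_simp
      rw [h6, abs_mul, abs_of_pos hs]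
      calc _ ≤ √(m n : ℝ) * (ε / (2 * (|t₀| + 2)) * (|t n / √(m n : ℝ)| + 1 / √(m n : ℝ))) := by
            gcongr
        _ = ε / (2 * (|t₀| + 2)) * (|t n| + 1) := by
            rw [abs_div, abs_of_pos hs]; field_simp
        _ ≤ ε / (2 * (|t₀| + 2)) * (|t₀| + 2) :=
            mul_le_mul_of_nonneg_left (by linarith) (by positivity)
        _ = ε / 2 := by field_simp
        _ < ε := by linarith
    have := hsub.add (ht.const_mul f₀)
    rw [zero_add] at this
    exact this.congr fun n => by ring
  have hlim := tendsto_measureReal_sampleQuantile_le hp0 hp1 ν hm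
    (fun n => c n + t n / √(m n : ℝ)) hb
  rw [gaussianReal_Iic_eq hf₀ (mul_nonneg hp0.le (by linarith))] at hlim
  refine hlim.congr' ?_
  filter_upwards [hpos] with n hn
  have hs : 0 < √(m n : ℝ) := by positivity
  congr 1
  ext y
  simp only [Set.mem_ofPred_eq]
  rw [← le_div_iff₀' hs, sub_le_iff_le_add']

theorem tendsto_variance_sqrt_mul_sampleQuantile_sub {p : ℝ} (hp0 : 0 < p) (hp1 : p < 1)
    (ν : ℕ → Measure ℝ) [∀ n, IsProbabilityMeasure (ν n)] {m : ℕ → ℕ}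
    (hm : Tendsto m atTop atTop) (c : ℕ → ℝ) {f₀ : ℝ} (hf₀ : 0 < f₀)
    (hloc : ∀ ε > 0, ∃ δ > 0, ∀ᶠ n in atTop, ∀ u, |u| ≤ δ →
      |(ν n).real (Set.Iic (c n + u)) - p - f₀ * u| ≤ ε * (|u| + 1 / √(m n : ℝ)))
    {α : ℝ} (hα : 0 < α) {B M : ℝ} (hc : ∀ᶠ n in atTop, |c n| ≤ B)
    (hint : ∀ n, Integrable (fun x : ℝ => |x| ^ α) (ν n))
    (hM : ∀ᶠ n in atTop, ∫ x, |x| ^ α ∂(ν n) ≤ M) :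
    Tendsto (fun n => Var[fun y : Fin (m n) → ℝ => √(m n : ℝ) * (sampleQuantile p y - c n);
        Measure.pi (fun _ : Fin (m n) => ν n)]) atTop (𝓝 (p * (1 - p) / f₀ ^ 2)) := by
  have hv : 0 < p * (1 - p) / f₀ ^ 2 := by
    have : 0 < 1 - p := by linarith
    positivity
  have hmeas : ∀ n, Measurable
      (fun y : Fin (m n) → ℝ => √(m n : ℝ) * (sampleQuantile p y - c n)) := fun n =>
    ((measurable_sampleQuantile hp0 hp1.le _).sub_const _).const_mul _
  let ρ : ℕ → ProbabilityMeasure ℝ := fun n =>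
    ⟨(Measure.pi (fun _ : Fin (m n) => ν n)).map
      (fun y => √(m n : ℝ) * (sampleQuantile p y - c n)),
      Measure.isProbabilityMeasure_map (hmeas n).aemeasurable⟩
  let ρ₀ : ProbabilityMeasure ℝ := ⟨gaussianReal 0 (p * (1 - p) / f₀ ^ 2).toNNReal, inferInstance⟩
  have hatom : NullSingletonClass (ρ₀ : Measure ℝ) :=
    nullSingletonClass_gaussianReal (by simpa using hv)
  have hρ : Tendsto ρ atTop (𝓝 ρ₀) := by
    refine tendsto_probabilityMeasure_of_tendsto_Iic fun t => ?_
    refine (tendsto_measureReal_sqrt_mul_sampleQuantile_sub_le hp0 hp1 ν hm c hf₀ hloc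
      (tendsto_const_nhds (x := t))).congr fun n => ?_
    change _ = ((Measure.pi (fun _ : Fin (m n) => ν n)).map
      (fun y => √(m n : ℝ) * (sampleQuantile p y - c n))).real (Set.Iic t)
    rw [map_measureReal_apply (hmeas n) measurableSet_Iic]
    rfl
  have hL2 : MemLp id 2 (ρ₀ : Measure ℝ) := memLp_id_gaussianReal 2
  obtain ⟨δ, hδ, hev⟩ := hloc (f₀ / 4) (by positivity)
  obtain ⟨K, k₀, hK⟩ := exists_tail_bound hp0 hp1 hα hf₀ hδ B M
  have htail : ∀ᶠ n in atTop, ∀ t : ℝ, 1 ≤ t →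
      (ρ n : Measure ℝ).real {x | t < |x|} ≤ K / t ^ 4 := by
    filter_upwards [hev, hc, hM, hm.eventually_ge_atTop k₀] with n h1 h2 h3 h4 t ht
    have hset : MeasurableSet {x : ℝ | t < |x|} := measurableSet_lt measurable_const measurable_norm
    change ((Measure.pi (fun _ : Fin (m n) => ν n)).map
      (fun y => √(m n : ℝ) * (sampleQuantile p y - c n))).real _ ≤ _
    rw [map_measureReal_apply (hmeas n) hset]
    exact hK (m n) h4 (ν n) (c n) h2 (hint n) h3 h1 t ht
  have hlim := tendsto_variance_of_tail_bound hρ hL2 htail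
  have hG : Var[id; (ρ₀ : Measure ℝ)] = p * (1 - p) / f₀ ^ 2 := by
    change Var[id; gaussianReal 0 (p * (1 - p) / f₀ ^ 2).toNNReal] = _
    rw [variance_id_gaussianReal, Real.coe_toNNReal _ hv.le]
  rw [hG] at hlim
  refine hlim.congr fun n => ?_
  exact variance_id_map (hmeas n).aemeasurable

/-! ### Distribution function and cell counts near the quantile -/

/-- A continuous local density is a strict derivative of the distribution function. -/
theorem exists_abs_measureReal_Ioc_sub_le {ν : Measure ℝ} [IsProbabilityMeasure ν] {f : ℝ → ℝ}
    {μ : ℝ} (hf : HasPosContDensityNear ν f μ) {ε : ℝ} (hε : 0 < ε) :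
    ∃ δ > 0, ∀ s t, μ - δ ≤ s → s ≤ t → t ≤ μ + δ →
      |ν.real (Set.Ioc s t) - f μ * (t - s)| ≤ ε * (t - s) := by
  obtain ⟨U, hU, hμU, hcont, hposU, hdens⟩ := hf
  have hc : ContinuousAt f μ := hcont.continuousAt (hU.mem_nhds hμU)
  have hnear : ∀ᶠ x in 𝓝 μ, x ∈ U ∧ |f x - f μ| < ε :=
    Filter.Eventually.and (hU.mem_nhds hμU) (Metric.tendsto_nhds.1 hc ε hε)
  obtain ⟨δ, hδ, hball⟩ := Metric.eventually_nhds_iff.1 hnear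
  refine ⟨δ / 2, by positivity, fun s t hs hst ht => ?_⟩
  have hmem : ∀ x ∈ Set.Ioc s t, x ∈ U ∧ |f x - f μ| < ε := by
    intro x hx
    refine hball ?_
    rw [Real.dist_eq, abs_lt]
    constructor <;> linarith [hx.1, hx.2]
  have hsub : Set.Ioc s t ⊆ U := fun x hx => (hmem x hx).1
  have hν : ν (Set.Ioc s t) = ∫⁻ x in Set.Ioc s t, ENNReal.ofReal (f x) := by
    calc ν (Set.Ioc s t) = ν.restrict U (Set.Ioc s t) := by
          rw [Measure.restrict_apply measurableSet_Ioc, Set.inter_eq_left.2 hsub]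
      _ = _ := by
          rw [hdens, withDensity_apply _ measurableSet_Ioc,
            Measure.restrict_restrict measurableSet_Ioc, Set.inter_eq_left.2 hsub]
  have hvol : volume (Set.Ioc s t) = ENNReal.ofReal (t - s) := Real.volume_Ioc
  have hup : ν.real (Set.Ioc s t) ≤ (f μ + ε) * (t - s) := by
    have hp : 0 ≤ f μ + ε := by linarith [hposU μ hμU]
    refine ENNReal.toReal_le_of_le_ofReal (mul_nonneg hp (by linarith)) ?_
    rw [hν, ENNReal.ofReal_mul hp, ← hvol, ← setLIntegral_const]
    refine setLIntegral_mono' measurableSet_Ioc fun x hx => ENNReal.ofReal_le_ofReal ?_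
    linarith [(abs_lt.1 (hmem x hx).2).2]
  have hlo : (f μ - ε) * (t - s) ≤ ν.real (Set.Ioc s t) := by
    rcases le_or_gt (f μ - ε) 0 with h | h
    · exact (mul_nonpos_of_nonpos_of_nonneg h (by linarith)).trans measureReal_nonneg
    · rw [measureReal_def, ← ENNReal.ofReal_le_iff_le_toReal (measure_ne_top _ _), hν,
        ENNReal.ofReal_mul h.le, ← hvol, ← setLIntegral_const]
      refine setLIntegral_mono' measurableSet_Ioc fun x hx => ENNReal.ofReal_le_ofReal ?_
      linarith [(abs_lt.1 (hmem x hx).2).1]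
  rw [abs_le]
  constructor <;> linarith

theorem measureReal_Iic_eq_of_isUniqueQuantile {ν : Measure ℝ} [IsProbabilityMeasure ν]
    {f : ℝ → ℝ} {p μ : ℝ} (hμ : IsUniqueQuantile ν p μ) (hf : HasPosContDensityNear ν f μ) :
    ν.real (Set.Iic μ) = p := by
  obtain ⟨U, hU, hμU, -, -, hdens⟩ := hf
  have h0 : ν {μ} = 0 := by
    calc ν {μ} = ν.restrict U {μ} := by
          rw [Measure.restrict_apply (measurableSet_singleton μ),
            Set.inter_eq_left.2 (Set.singleton_subset_iff.2 hμU)]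
      _ = 0 := by
          rw [hdens]
          refine withDensity_absolutelyContinuous _ _ ?_
          exact Measure.restrict_le_self.absolutelyContinuous Real.volume_singleton
  obtain ⟨h1, h2⟩ := (hμ μ).2 rfl
  refine le_antisymm (le_trans ?_ h1) h2
  rw [← Set.Iio_union_right]
  refine (measureReal_union_le _ _).trans ?_
  simp [measureReal_def, h0]

/-- Deviation bound for the count of a cell of measure of order `h`: the exponent `n h` is of the
order of the expected count. -/
theorem measureReal_abs_sum_indicator_sub_ge_le (ν : Measure ℝ) [IsProbabilityMeasure ν]
    {A : Set ℝ} (hA : MeasurableSet A) (n : ℕ) {L h η : ℝ} (hη : 0 < η) (hηL : η ≤ L)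
    (hq : ν.real A ≤ L * h) :
    (Measure.pi (fun _ : Fin n => ν)).real
        {y | n * (η * h) ≤ |∑ i, A.indicator (fun _ => (1 : ℝ)) (y i) - n * ν.real A|}
      ≤ 2 * Real.exp (-(η ^ 2 / (4 * L) * (n * h))) := by
  have hL : 0 < L := lt_of_lt_of_le hη hηL
  -- the minimizer of `l ↦ -l η + L l ^ 2`
  set l := η / (2 * L) with hl
  have hl0 : 0 < l := by positivity
  have hl1 : l ≤ 1 := by rw [hl, div_le_one (by positivity)]; linarith
  have hlL : L * l = η / 2 := by rw [hl]; field_simp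
  have hexp : (n : ℝ) * (ν.real A * l ^ 2) ≤ n * h * (l * (η / 2)) := by
    calc (n : ℝ) * (ν.real A * l ^ 2) ≤ n * (L * h * l ^ 2) := by gcongr
      _ = n * h * (l * (L * l)) := by ring
      _ = _ := by rw [hlL]
  have hc : η ^ 2 / (4 * L) * (n * h) = n * h * (l * (η / 2)) := by
    rw [hl]; field_simp; ring
  have h1 := measureReal_mul_sum_indicator_ge_le_exp ν hA n (l := l)
    (by rwa [abs_of_pos hl0]) (l * (n * (ν.real A + η * h)))
  have h2 := measureReal_mul_sum_indicator_ge_le_exp ν hA n (l := -l)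
    (by rwa [abs_neg, abs_of_pos hl0]) (-l * (n * (ν.real A - η * h)))
  have hsub : {y : Fin n → ℝ |
      n * (η * h) ≤ |∑ i, A.indicator (fun _ => (1 : ℝ)) (y i) - n * ν.real A|}
      ⊆ {y | l * (n * (ν.real A + η * h)) ≤ l * ∑ i, A.indicator (fun _ => (1 : ℝ)) (y i)}
        ∪ {y | -l * (n * (ν.real A - η * h)) ≤ -l * ∑ i, A.indicator (fun _ => (1 : ℝ)) (y i)} := by
    intro y hy
    rw [Set.mem_ofPred_eq, le_abs] at hy
    rcases hy with hy | hy
    · left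
      rw [Set.mem_ofPred_eq]
      exact mul_le_mul_of_nonneg_left (by linarith) hl0.le
    · right
      rw [Set.mem_ofPred_eq]
      exact mul_le_mul_of_nonpos_left (by linarith) (by linarith)
  refine (measureReal_mono hsub).trans ((measureReal_union_le _ _).trans ?_)
  rw [two_mul, hc]
  refine add_le_add (h1.trans ?_) (h2.trans ?_)
  · rw [Real.exp_le_exp]; linarith
  · rw [Real.exp_le_exp]; linarith

theorem abs_sub_sub_le_of_grid {G : ℝ → ℝ} (hG : Monotone G) {a h f₀ η : ℝ} (hh : 0 < h)
    (hf₀ : 0 ≤ f₀) (hη : 0 ≤ η) {J : ℕ}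
    (hcell : ∀ j < J, |G (a + (j + 1) * h) - G (a + j * h) - f₀ * h| ≤ η * h)
    {s t : ℝ} (has : a ≤ s) (hst : s ≤ t) (htJ : t + h ≤ a + J * h) :
    |G t - G s - f₀ * (t - s)| ≤ η * (t - s) + 2 * h * (f₀ + η) := by
  have htel : ∀ i k : ℕ, i ≤ k → k ≤ J →
      |G (a + k * h) - G (a + i * h) - f₀ * ((k - i) * h)| ≤ η * ((k - i) * h) := by
    intro i k hik
    induction k, hik using Nat.le_induction with
    | base => intro _; simp
    | succ k hik ih =>
      intro hkJ
      have h1 := ih (by omega)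
      have h2 := hcell k (by omega)
      rw [abs_le] at h1 h2 ⊢
      push_cast
      constructor <;> linarith [h1.1, h1.2, h2.1, h2.2]
  set i := ⌊(s - a) / h⌋₊ with hi
  set k := ⌊(t - a) / h⌋₊ with hk
  have hi1 : (i : ℝ) * h ≤ s - a := by
    rw [← le_div_iff₀ hh]; exact Nat.floor_le (div_nonneg (by linarith) hh.le)
  have hi2 : s - a < (i + 1) * h := by
    rw [← div_lt_iff₀ hh]; exact Nat.lt_floor_add_one _
  have hk1 : (k : ℝ) * h ≤ t - a := by
    rw [← le_div_iff₀ hh]; exact Nat.floor_le (div_nonneg (by linarith) hh.le)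
  have hk2 : t - a < (k + 1) * h := by
    rw [← div_lt_iff₀ hh]; exact Nat.lt_floor_add_one _
  have hik : i ≤ k := Nat.floor_le_floor (by gcongr)
  have hkJ : k + 1 ≤ J := by
    have h1 : ((k + 1 : ℕ) : ℝ) * h ≤ J * h := by push_cast; linarith
    exact_mod_cast le_of_mul_le_mul_right h1 hh
  rw [abs_le]
  constructor
  · rcases Nat.lt_or_ge i k with hlt | hge
    · have h1 := (abs_le.1 (htel (i + 1) k hlt (by omega))).1
      have h2 : G (a + k * h) ≤ G t := hG (by linarith)
      have h3 : G s ≤ G (a + ((i + 1 : ℕ) : ℝ) * h) := hG (by push_cast; linarith)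
      push_cast at h1 h3
      have h4 : ((k : ℝ) - (i + 1)) * h ≤ t - s := by linarith
      have h5 : t - s - 2 * h ≤ ((k : ℝ) - (i + 1)) * h := by linarith
      have h6 : f₀ * (t - s - 2 * h) ≤ f₀ * (((k : ℝ) - (i + 1)) * h) := by gcongr
      have h7 : η * (((k : ℝ) - (i + 1)) * h) ≤ η * (t - s) := by gcongr
      have h8 : 0 ≤ η * h := by positivity
      linarith
    · have hki : k = i := le_antisymm hge hik
      rw [hki] at hk2
      have h1 : G s ≤ G t := hG hst
      have h2 : f₀ * (t - s) ≤ f₀ * h := by gcongr; linarith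
      have h3 : 0 ≤ η * (t - s) := mul_nonneg hη (by linarith)
      have h4 : 0 ≤ η * h := by positivity
      have h5 : 0 ≤ f₀ * h := by positivity
      linarith
  · have h1 := (abs_le.1 (htel i (k + 1) (by omega) hkJ)).2
    have h2 : G t ≤ G (a + ((k + 1 : ℕ) : ℝ) * h) := hG (by push_cast; linarith)
    have h3 : G (a + i * h) ≤ G s := hG (by linarith)
    push_cast at h1 h2
    have h5 : ((k : ℝ) + 1 - i) * h ≤ t - s + 2 * h := by linarith
    have h6 : f₀ * (((k : ℝ) + 1 - i) * h) ≤ f₀ * (t - s + 2 * h) := by gcongr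
    have h7 : η * (((k : ℝ) + 1 - i) * h) ≤ η * (t - s + 2 * h) := by gcongr
    linarith

theorem summable_sqrt_mul_exp_neg_mul_sqrt {c : ℝ} (hc : 0 < c) :
    Summable fun n : ℕ => √(n : ℝ) * Real.exp (-(c * √(n : ℝ))) := by
  have hs : Summable fun n : ℕ => (120 / c ^ 5) * (1 / (n : ℝ) ^ 2) :=
    (Real.summable_one_div_nat_pow.2 one_lt_two).mul_left _
  refine Summable.of_nonneg_of_le (fun n => by positivity) (fun n => ?_) hs
  rcases Nat.eq_zero_or_pos n with rfl | hn
  · simp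
  have hs0 : 0 < √(n : ℝ) := by positivity
  have h1 := Real.pow_div_factorial_le_exp (x := c * √(n : ℝ)) (by positivity) 5
  have h2 : Real.exp (-(c * √(n : ℝ))) ≤ 120 / (c * √(n : ℝ)) ^ 5 := by
    rw [Real.exp_neg, inv_eq_one_div, div_le_div_iff₀ (Real.exp_pos _) (by positivity)]
    rw [div_le_iff₀ (by positivity)] at h1
    norm_num [Nat.factorial] at h1
    linarith
  have h4 : (n : ℝ) ^ 2 = √(n : ℝ) ^ 4 := by
    calc (n : ℝ) ^ 2 = (√(n : ℝ) ^ 2) ^ 2 := by rw [Real.sq_sqrt (by positivity)]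
      _ = _ := by ring
  calc √(n : ℝ) * Real.exp (-(c * √(n : ℝ))) ≤ √(n : ℝ) * (120 / (c * √(n : ℝ)) ^ 5) := by gcongr
    _ = (120 / c ^ 5) * (1 / (n : ℝ) ^ 2) := by rw [h4]; field_simp

/-! ### Local linearity of the empirical distribution function -/

theorem map_sample_eq_pi {Ω : Type*} [MeasurableSpace Ω] {P : Measure Ω} [IsProbabilityMeasure P]
    {ν : Measure ℝ} {X : ℕ → Ω → ℝ} (hX : ∀ i, HasLaw (X i) ν P) (hindep : iIndepFun X P) (n : ℕ) :
    P.map (fun ω (i : Fin n) => X i ω) = Measure.pi (fun _ : Fin n => ν) := by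
  have h1 : iIndepFun (fun i : Fin n => X i) P := hindep.precomp Fin.val_injective
  rw [(iIndepFun_iff_map_fun_eq_pi_map fun i : Fin n => (hX i).aemeasurable).1 h1]
  simp_rw [fun i : Fin n => (hX i).map_eq]

/-- Local oscillation of the empirical process on the scale `1 / √n`, with a fixed precision `η`:
the cells of a grid of mesh `η / √n` are controlled simultaneously by the Chernoff bound and the
Borel–Cantelli lemma. -/
theorem ae_exists_abs_ecdf_sub_le_mul {Ω : Type*} [MeasurableSpace Ω] {P : Measure Ω}
    [IsProbabilityMeasure P] {ν : Measure ℝ} [IsProbabilityMeasure ν] {X : ℕ → Ω → ℝ}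
    (hX : ∀ i, HasLaw (X i) ν P) (hindep : iIndepFun X P) {f : ℝ → ℝ} {μ : ℝ} (hfμ : 0 < f μ)
    (hf : HasPosContDensityNear ν f μ) {η : ℝ} (hη : 0 < η) :
    ∃ δ > 0, ∀ᵐ ω ∂P, ∀ᶠ n : ℕ in atTop, ∀ s t, μ - δ ≤ s → s ≤ t → t ≤ μ + δ →
      |ecdf (fun i : Fin n => X i ω) t - ecdf (fun i : Fin n => X i ω) s - f μ * (t - s)|
        ≤ 2 * η * (t - s) + 2 * (η / √(n : ℝ)) * (f μ + 2 * η) := by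
  obtain ⟨δ, hδ, hdens⟩ := exists_abs_measureReal_Ioc_sub_le hf hη
  set h : ℕ → ℝ := fun n => η / √(n : ℝ) with hh
  set g : ℕ → ℕ → ℝ := fun n j => μ - δ + j * h n with hg
  set J : ℕ → ℕ := fun n => ⌊2 * δ / h n⌋₊ with hJ
  set L := f μ + η with hL
  set c := η ^ 2 / (4 * L) * η with hc
  have hL0 : 0 < L := by positivity
  have hc0 : 0 < c := by positivity
  have hh0 : ∀ n, n ≠ 0 → 0 < h n := fun n hn => by simp only [hh]; positivity
  have hJle : ∀ n, n ≠ 0 → (J n : ℝ) * h n ≤ 2 * δ := fun n hn => by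
    rw [← le_div_iff₀ (hh0 n hn)]
    exact Nat.floor_le (div_nonneg (by linarith) (hh0 n hn).le)
  have hJge : ∀ n, n ≠ 0 → 2 * δ - h n ≤ (J n : ℝ) * h n := fun n hn => by
    have h1 : 2 * δ < (J n + 1) * h n := by
      rw [← div_lt_iff₀ (hh0 n hn)]; exact Nat.lt_floor_add_one _
    linarith
  have hcell : ∀ n, n ≠ 0 → ∀ j < J n,
      |ν.real (Set.Ioc (g n j) (g n (j + 1))) - f μ * h n| ≤ η * h n := by
    intro n hn j hj
    have h0 := hh0 n hn
    have h1 : ((j + 1 : ℕ) : ℝ) * h n ≤ J n * h n := by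
      gcongr; exact hj
    have h2 := hJle n hn
    have h3 : 0 ≤ (j : ℝ) * h n := by positivity
    have h4 : g n (j + 1) - g n j = h n := by simp only [hg]; push_cast; ring
    have h5 := hdens (g n j) (g n (j + 1)) (by simp only [hg]; linarith) (by linarith)
      (by simp only [hg]; linarith)
    rwa [h4] at h5
  let E : (n : ℕ) → ℕ → Set (Fin n → ℝ) := fun n j => {x | n * (η * h n) ≤
    |∑ i : Fin n, (Set.Ioc (g n j) (g n (j + 1))).indicator (fun _ => (1 : ℝ)) (x i)
      - n * ν.real (Set.Ioc (g n j) (g n (j + 1)))|}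
  let bad : ℕ → Set Ω := fun n => ⋃ j ∈ Finset.range (J n), {ω | (fun i : Fin n => X i ω) ∈ E n j}
  have hE : ∀ n, n ≠ 0 → ∀ j < J n,
      P {ω | (fun i : Fin n => X i ω) ∈ E n j}
        ≤ ENNReal.ofReal (2 * Real.exp (-(c * √(n : ℝ)))) := by
    intro n hn j hj
    set A := Set.Ioc (g n j) (g n (j + 1)) with hA
    have hAm : MeasurableSet A := measurableSet_Ioc
    have hind : Measurable (A.indicator (fun _ => (1 : ℝ))) := measurable_const.indicator hAm
    have hEm : MeasurableSet {y : Fin n → ℝ |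
        n * (η * h n) ≤ |∑ i, A.indicator (fun _ => (1 : ℝ)) (y i) - n * ν.real A|} :=
      measurableSet_le measurable_const (by fun_prop)
    have hq : ν.real A ≤ L * h n := by
      have := (abs_le.1 (hcell n hn j hj)).2
      rw [hL]; linarith
    have h1 := measureReal_abs_sum_indicator_sub_ge_le ν hAm n hη (by linarith : η ≤ L) hq
    have h2 : η ^ 2 / (4 * L) * (n * h n) = c * √(n : ℝ) := by
      have h3 : (n : ℝ) * h n = η * √(n : ℝ) := by
        simp only [hh]
        have hs : √(n : ℝ) * √(n : ℝ) = n := Real.mul_self_sqrt (by positivity)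
        have hs0 : √(n : ℝ) ≠ 0 := by positivity
        rw [mul_div_assoc', div_eq_iff hs0, mul_assoc, hs]; ring
      rw [h3, hc]; ring
    rw [h2] at h1
    have hmap := map_sample_eq_pi hX hindep n
    have h4 : P {ω | (fun i : Fin n => X i ω) ∈ E n j}
        = (Measure.pi (fun _ : Fin n => ν)) {y : Fin n → ℝ |
        n * (η * h n) ≤ |∑ i, A.indicator (fun _ => (1 : ℝ)) (y i) - n * ν.real A|} := by
      rw [← hmap, Measure.map_apply_of_aemeasurable
        (aemeasurable_pi_lambda (fun ω (i : Fin n) => X i ω) fun i => (hX i).aemeasurable) hEm]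
      rfl
    rw [h4, ← ofReal_measureReal]
    exact ENNReal.ofReal_le_ofReal h1
  have hbad : ∀ n, P (bad n) ≤
      ENNReal.ofReal ((4 * δ / η) * (√(n : ℝ) * Real.exp (-(c * √(n : ℝ))))) := by
    intro n
    rcases eq_or_ne n 0 with rfl | hn
    -- for `n = 0` the mesh is `η / 0 = 0` and there are no cells
    · simp [bad, hJ, hh]
    · calc P (bad n) ≤ ∑ j ∈ Finset.range (J n), P {ω | (fun i : Fin n => X i ω) ∈ E n j} :=
            measure_biUnion_finset_le _ _
        _ ≤ ∑ _j ∈ Finset.range (J n), ENNReal.ofReal (2 * Real.exp (-(c * √(n : ℝ)))) :=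
            Finset.sum_le_sum fun j hj => hE n hn j (Finset.mem_range.1 hj)
        _ = ENNReal.ofReal (J n * (2 * Real.exp (-(c * √(n : ℝ))))) := by
            rw [Finset.sum_const, Finset.card_range, nsmul_eq_mul,
              ENNReal.ofReal_mul (p := (J n : ℝ)) (by positivity),
              ENNReal.ofReal_natCast]
        _ ≤ _ := by
            refine ENNReal.ofReal_le_ofReal ?_
            have h1 : (J n : ℝ) ≤ 2 * δ / η * √(n : ℝ) := by
              have := hJle n hn
              rw [← le_div_iff₀ (hh0 n hn)] at this
              refine this.trans_eq ?_
              simp only [hh]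
              field_simp
            calc (J n : ℝ) * (2 * Real.exp (-(c * √(n : ℝ))))
                ≤ 2 * δ / η * √(n : ℝ) * (2 * Real.exp (-(c * √(n : ℝ)))) := by gcongr
              _ = _ := by ring
  have hsum : ∑' n, P (bad n) ≠ ⊤ := by
    refine ne_top_of_le_ne_top ?_ (ENNReal.tsum_le_tsum hbad)
    exact ((summable_sqrt_mul_exp_neg_mul_sqrt hc0).mul_left _).tsum_ofReal_ne_top
  refine ⟨δ / 2, by positivity, ?_⟩
  filter_upwards [ae_eventually_notMem hsum] with ω hω
  have hhlim : Tendsto h atTop (𝓝 0) :=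
    tendsto_const_nhds.div_atTop (Real.tendsto_sqrt_atTop.comp tendsto_natCast_atTop_atTop)
  filter_upwards [hω, eventually_ne_atTop 0,
    hhlim.eventually_le_const (show 0 < δ / 4 by positivity)] with n hn hn0 hhn s t hs hst ht
  have hgrid := abs_sub_sub_le_of_grid (ecdf_mono (fun i : Fin n => X i ω)) (a := μ - δ)
    (h := h n) (f₀ := f μ) (η := 2 * η) (hh0 n hn0) hfμ.le (by positivity) (J := J n) ?_
    (s := s) (t := t) (by linarith) hst (by have := hJge n hn0; linarith)
  · exact hgrid
  · intro j hj
    have hnot : (fun i : Fin n => X i ω) ∉ E n j := fun hmem => hn <| by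
      simp only [bad, Set.mem_iUnion]
      exact ⟨j, Finset.mem_range.2 hj, hmem⟩
    simp only [E, Set.mem_ofPred_eq, not_le] at hnot
    have h1 := hcell n hn0 j hj
    have h2 : μ - δ + ((j : ℝ) + 1) * h n = g n (j + 1) := by simp only [hg]; push_cast; ring
    have h3 : μ - δ + (j : ℝ) * h n = g n j := rfl
    have h4 : g n j ≤ g n (j + 1) := by
      have := hh0 n hn0
      rw [← h2, ← h3]; linarith
    rw [h2, h3, ecdf_sub_ecdf _ h4]
    have hnpos : (0 : ℝ) < n := by positivity
    set S := ∑ i : Fin n, (Set.Ioc (g n j) (g n (j + 1))).indicator (fun _ => (1 : ℝ)) (X i ω)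
    set q := ν.real (Set.Ioc (g n j) (g n (j + 1)))
    have h5 : |(n : ℝ)⁻¹ * S - q| ≤ η * h n := by
      have h6 : (n : ℝ)⁻¹ * S - q = (S - n * q) / n := by field_simp
      rw [h6, abs_div, abs_of_pos hnpos, div_le_iff₀ hnpos]
      linarith
    rw [abs_le] at h1 h5 ⊢
    constructor <;> linarith [h1.1, h1.2, h5.1, h5.2]

/-- Almost surely the empirical distribution function is asymptotically linear near `μ` with slope
`f μ`, uniformly over pairs of points, up to an error that is small compared with
`(t - s) + 1 / √n`. -/
theorem ae_exists_abs_ecdf_sub_le {Ω : Type*} [MeasurableSpace Ω] {P : Measure Ω}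
    [IsProbabilityMeasure P] {ν : Measure ℝ} [IsProbabilityMeasure ν] {X : ℕ → Ω → ℝ}
    (hX : ∀ i, HasLaw (X i) ν P) (hindep : iIndepFun X P) {f : ℝ → ℝ} {μ : ℝ}
    (hf : HasPosContDensityNear ν f μ) :
    ∀ᵐ ω ∂P, ∀ ε > 0, ∃ δ > 0, ∀ᶠ n : ℕ in atTop, ∀ s t, μ - δ ≤ s → s ≤ t → t ≤ μ + δ →
      |ecdf (fun i : Fin n => X i ω) t - ecdf (fun i : Fin n => X i ω) s - f μ * (t - s)|
        ≤ ε * ((t - s) + 1 / √(n : ℝ)) := by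
  have hfμ : 0 < f μ := by
    obtain ⟨U, -, hμU, -, hpos, -⟩ := hf
    exact hpos μ hμU
  choose δ hδ hae using fun k : ℕ => ae_exists_abs_ecdf_sub_le_mul hX hindep hfμ hf
    (Nat.one_div_pos_of_nat (n := k) (α := ℝ))
  filter_upwards [ae_all_iff.2 hae] with ω hω ε hε
  obtain ⟨k, hk⟩ := exists_nat_one_div_lt (show 0 < min 1 (ε / (2 * (f μ + 2))) by positivity)
  refine ⟨δ k, hδ k, ?_⟩
  filter_upwards [hω k, eventually_ne_atTop 0] with n hn hn0 s t hs hst ht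
  refine (hn s t hs hst ht).trans ?_
  set η := 1 / ((k : ℝ) + 1) with hη
  have hη0 : 0 < η := by positivity
  have h1 : η ≤ 1 := hk.le.trans (min_le_left _ _)
  have h2 : η * (2 * (f μ + 2)) ≤ ε := by
    rw [← le_div_iff₀ (by positivity)]
    exact hk.le.trans (min_le_right _ _)
  have h3 : 2 * η ≤ ε := by nlinarith
  have h4 : 2 * η * (f μ + 2 * η) ≤ ε := by nlinarith
  have hs0 : 0 < √(n : ℝ) := by positivity
  calc 2 * η * (t - s) + 2 * (η / √(n : ℝ)) * (f μ + 2 * η)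
      = 2 * η * (t - s) + 2 * η * (f μ + 2 * η) * (1 / √(n : ℝ)) := by ring
    _ ≤ ε * (t - s) + ε * (1 / √(n : ℝ)) := by
        have : 0 ≤ t - s := by linarith
        gcongr
    _ = _ := by ring

/-- Under asymptotic linearity of the empirical distribution functions, the sample quantiles are
consistent and the empirical distribution functions may be recentred at them. -/
theorem tendsto_sampleQuantile_and_abs_ecdf_sub_le {p : ℝ} (hp0 : 0 < p) (hp1 : p < 1)
    {x : (n : ℕ) → Fin n → ℝ} {μ f₀ : ℝ} (hf₀ : 0 < f₀)
    (hlin : ∀ ε > 0, ∃ δ > 0, ∀ᶠ n : ℕ in atTop, ∀ s t, μ - δ ≤ s → s ≤ t → t ≤ μ + δ →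
      |ecdf (x n) t - ecdf (x n) s - f₀ * (t - s)| ≤ ε * ((t - s) + 1 / √(n : ℝ)))
    (hμ : Tendsto (fun n => ecdf (x n) μ) atTop (𝓝 p)) :
    Tendsto (fun n => sampleQuantile p (x n)) atTop (𝓝 μ) ∧
    ∀ ε > 0, ∃ δ > 0, ∀ᶠ n : ℕ in atTop, ∀ u, |u| ≤ δ →
      |ecdf (x n) (sampleQuantile p (x n) + u) - p - f₀ * u| ≤ ε * (|u| + 1 / √(n : ℝ)) := by
  have hinv : Tendsto (fun n : ℕ => 1 / √(n : ℝ)) atTop (𝓝 0) :=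
    tendsto_const_nhds.div_atTop (Real.tendsto_sqrt_atTop.comp tendsto_natCast_atTop_atTop)
  have hcons : Tendsto (fun n => sampleQuantile p (x n)) atTop (𝓝 μ) := by
    rw [Metric.tendsto_atTop']
    intro r hr
    obtain ⟨δ, hδ, hev⟩ := hlin (f₀ / 4) (by positivity)
    set d := min (r / 2) δ with hd
    have hd0 : 0 < d := lt_min (by positivity) hδ
    have hdδ : d ≤ δ := min_le_right _ _
    have hdr : d ≤ r / 2 := min_le_left _ _
    have hfd : 0 < f₀ * d := by positivity
    have hμe : ∀ᶠ n in atTop, |ecdf (x n) μ - p| < f₀ * d / 4 :=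
      Metric.tendsto_nhds.1 hμ _ (by positivity)
    refine eventually_atTop.1 ?_ |>.imp fun N hN n hn => hN n hn.le
    filter_upwards [hev, hμe, hinv.eventually_le_const hd0, eventually_ne_atTop 0]
      with n h1 h2 h3 h4
    rw [abs_lt] at h2
    have hup := (abs_le.1 (h1 μ (μ + d) (by linarith) (by linarith) (by linarith))).1
    have hlo := (abs_le.1 (h1 (μ - d) μ (by linarith) (by linarith) (by linarith))).1
    have h5 : f₀ / 4 * (d + 1 / √(n : ℝ)) ≤ f₀ / 4 * (d + d) := by gcongr
    have h6 : sampleQuantile p (x n) ≤ μ + d := by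
      rw [sampleQuantile_le_iff hp0 hp1.le h4]
      rw [add_sub_cancel_left] at hup
      linarith
    have h7 : μ - d < sampleQuantile p (x n) := by
      rw [← not_le, sampleQuantile_le_iff hp0 hp1.le h4, not_le]
      rw [sub_sub_cancel] at hlo
      linarith
    rw [Real.dist_eq, abs_lt]
    constructor <;> linarith
  refine ⟨hcons, fun ε hε => ?_⟩
  obtain ⟨δ, hδ, hev⟩ := hlin (ε / 3) (by positivity)
  set e := ε / 3 with he
  have he0 : 0 < e := by positivity
  refine ⟨δ / 2, by positivity, ?_⟩
  have hce : ∀ᶠ n in atTop, |sampleQuantile p (x n) - μ| < δ / 4 :=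
    Metric.tendsto_nhds.1 hcons _ (by positivity)
  have hstep : Tendsto (fun n : ℕ => e / (f₀ + e) * (1 / √(n : ℝ))) atTop (𝓝 0) := by
    simpa using hinv.const_mul (e / (f₀ + e))
  filter_upwards [hev, hce, hstep.eventually_le_const (show 0 < δ / 4 by positivity),
    eventually_ne_atTop 0] with n h1 h2 h3 h4 u hu
  rw [abs_lt] at h2
  set c := sampleQuantile p (x n) with hc
  have hs0 : 0 < √(n : ℝ) := by positivity
  -- just below the sample quantile, at distance `d`, the empirical distribution is below `p`
  set d := e / (f₀ + e) * (1 / √(n : ℝ)) with hd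
  have hd0 : 0 < d := by positivity
  have hGc : p ≤ ecdf (x n) c := (sampleQuantile_le_iff hp0 hp1.le h4 _ _).1 le_rfl
  have hGd : ecdf (x n) (c - d) < p := by
    rw [← not_le, ← sampleQuantile_le_iff hp0 hp1.le h4, not_le]
    linarith
  have hjump : ecdf (x n) c - p ≤ 2 * e * (1 / √(n : ℝ)) := by
    have h5 := (abs_le.1 (h1 (c - d) c (by linarith) (by linarith) (by linarith))).2
    rw [sub_sub_cancel] at h5
    have h6 : (f₀ + e) * d = e * (1 / √(n : ℝ)) := by rw [hd]; field_simp
    linarith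
  have hinc : |ecdf (x n) (c + u) - ecdf (x n) c - f₀ * u| ≤ e * (|u| + 1 / √(n : ℝ)) := by
    rcases le_total 0 u with h0 | h0
    · rw [abs_of_nonneg h0] at hu ⊢
      have h5 := h1 c (c + u) (by linarith) (by linarith) (by linarith)
      rwa [add_sub_cancel_left] at h5
    · rw [abs_of_nonpos h0] at hu ⊢
      have h5 := h1 (c + u) c (by linarith) (by linarith) (by linarith)
      have h6 : c - (c + u) = -u := by ring
      rw [h6] at h5
      rw [← abs_neg]
      convert h5 using 2
      ring
  have h7 : 0 ≤ e * |u| := by positivity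
  have h8 : 0 < e * (1 / √(n : ℝ)) := by positivity
  have h9 : ε = 3 * e := by rw [he]; ring
  rw [h9]
  rw [abs_le] at hinc ⊢
  constructor <;> linarith [hinc.1, hinc.2]

/-! ### Conditional and unconditional limits of the bootstrap -/

theorem ae_tendsto_sampleMean {Ω : Type*} [MeasurableSpace Ω] {P : Measure Ω}
    {ν : Measure ℝ} {X : ℕ → Ω → ℝ} (hX : ∀ i, HasLaw (X i) ν P) (hindep : iIndepFun X P)
    {g : ℝ → ℝ} (hg : Measurable g) (hint : Integrable g ν) :
    ∀ᵐ ω ∂P, Tendsto (fun n : ℕ => (n : ℝ)⁻¹ * ∑ i : Fin n, g (X i ω)) atTop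
      (𝓝 (∫ x, g x ∂ν)) := by
  have hlaw : ∀ i, P.map (X i) = ν := fun i => (hX i).map_eq
  have hint0 : Integrable (fun ω => g (X 0 ω)) P := by
    rw [← hlaw 0] at hint
    exact hint.comp_aemeasurable (hX 0).aemeasurable
  have hmean : ∫ ω, g (X 0 ω) ∂P = ∫ x, g x ∂ν := by
    rw [← hlaw 0, integral_map (hX 0).aemeasurable hg.aestronglyMeasurable]
  have hsl := strong_law_ae_real (fun i ω => g (X i ω)) hint0
    (fun i j hij => (hindep.indepFun hij).comp hg hg)
    (fun i => (IdentDistrib.mk (hX i).aemeasurable (hX 0).aemeasurable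
      ((hlaw i).trans (hlaw 0).symm)).comp hg)
  filter_upwards [hsl] with ω hω
  rw [hmean] at hω
  refine hω.congr fun n => ?_
  rw [div_eq_inv_mul, Finset.sum_range]

/-- The resampling law as the image of a fixed law on a finite set of index vectors. -/
theorem exists_resampleLaw_eq_map (m : ℕ) {n : ℕ} (hn : n ≠ 0) :
    ∃ π : Measure (Fin m → Fin n), IsProbabilityMeasure π ∧
      ∀ x : Fin n → ℝ, resampleLaw m x = π.map (fun σ j => x (σ j)) := by
  set U : Measure (Fin n) := (n : ENNReal)⁻¹ • ∑ i, Measure.dirac i with hU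
  have hprob : IsProbabilityMeasure U := by
    constructor
    simp [hU, ENNReal.inv_mul_cancel, hn]
  refine ⟨Measure.pi fun _ => U, inferInstance, fun x => ?_⟩
  have hx : Measurable x := measurable_of_countable x
  have hmap : U.map x = empiricalMeasure x := by
    rw [hU, Measure.map_smul, Measure.map_finset_sum (by fun_prop)]
    unfold empiricalMeasure
    congr 1
    exact Finset.sum_congr rfl fun i _ => Measure.map_dirac' hx i
  have : IsProbabilityMeasure (U.map x) := Measure.isProbabilityMeasure_map hx.aemeasurable
  rw [resampleLaw, ← hmap]
  exact (Measure.pi_map_pi (μ := fun _ : Fin m => U) (f := fun _ => x)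
    fun _ => hx.aemeasurable).symm

theorem measurable_bootVariance {p : ℝ} (hp0 : 0 < p) (hp1 : p ≤ 1) (m n : ℕ) :
    Measurable (fun x : Fin n → ℝ => bootVariance p m x) := by
  rcases eq_or_ne n 0 with rfl | hn
  · exact measurable_of_countable _
  obtain ⟨π, hπ, hmap⟩ := exists_resampleLaw_eq_map m hn
  have hQ := measurable_sampleQuantile hp0 hp1 m
  have hQn := measurable_sampleQuantile hp0 hp1 n
  have hsel : ∀ σ : Fin m → Fin n,
      Measurable (fun x : Fin n → ℝ => √(m : ℝ) *
        (sampleQuantile p (fun j => x (σ j)) - sampleQuantile p x)) := fun σ =>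
    ((hQ.comp (measurable_pi_lambda _ fun j => measurable_pi_apply _)).sub hQn).const_mul _
  have heq : (fun x : Fin n → ℝ => bootVariance p m x)
      = fun x => ∑ σ, π.real {σ} * (√(m : ℝ) *
          (sampleQuantile p (fun j => x (σ j)) - sampleQuantile p x)
        - ∑ σ', π.real {σ'} * (√(m : ℝ) *
          (sampleQuantile p (fun j => x (σ' j)) - sampleQuantile p x))) ^ 2 := by
    funext x
    have hx : Measurable (fun (σ : Fin m → Fin n) j => x (σ j)) := measurable_of_countable _
    unfold bootVariance
    rw [hmap x, variance_map ((hQ.sub_const _).const_mul _).aemeasurable hx.aemeasurable,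
      variance_eq_integral (measurable_of_countable _).aemeasurable,
      integral_fintype Integrable.of_finite, integral_fintype Integrable.of_finite]
    rfl
  rw [heq]
  fun_prop

theorem measurable_studentized {p : ℝ} (hp0 : 0 < p) (hp1 : p ≤ 1) (m n : ℕ) :
    Measurable (fun z : (Fin n → ℝ) × (Fin m → ℝ) => studentized p z.1 z.2) := by
  have h1 : Measurable fun z : (Fin n → ℝ) × (Fin m → ℝ) => sampleQuantile p z.2 :=
    (measurable_sampleQuantile hp0 hp1 m).comp measurable_snd
  have h2 : Measurable fun z : (Fin n → ℝ) × (Fin m → ℝ) => sampleQuantile p z.1 :=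
    (measurable_sampleQuantile hp0 hp1 n).comp measurable_fst
  have h3 : Measurable fun z : (Fin n → ℝ) × (Fin m → ℝ) => bootVariance p m z.1 :=
    (measurable_bootVariance hp0 hp1 m n).comp measurable_fst
  exact ((h1.sub h2).const_mul _).div h3.sqrt

theorem aemeasurable_studentized {Ω : Type*} [MeasurableSpace Ω] {P : Measure Ω} {p : ℝ}
    (hp0 : 0 < p) (hp1 : p ≤ 1) {m n : ℕ} {X : Ω → Fin n → ℝ} {Y : Ω → Fin m → ℝ}
    (hX : AEMeasurable X P) (hY : AEMeasurable Y P) :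
    AEMeasurable (fun ω => studentized p (X ω) (Y ω)) P :=
  (measurable_studentized hp0 hp1 m n).comp_aemeasurable' (f := fun ω => (X ω, Y ω))
    (hX.prodMk hY)

/-- The conditional limit theory of the bootstrap quantile for a single data sequence, under the
properties that hold for almost every realization of the data. -/
theorem tendsto_bootVariance_and_resampleLaw {p : ℝ} (hp0 : 0 < p) (hp1 : p < 1)
    {x : (n : ℕ) → Fin n → ℝ} {μ f₀ : ℝ} (hf₀ : 0 < f₀)
    (hlin : ∀ ε > 0, ∃ δ > 0, ∀ᶠ n : ℕ in atTop, ∀ s t, μ - δ ≤ s → s ≤ t → t ≤ μ + δ →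
      |ecdf (x n) t - ecdf (x n) s - f₀ * (t - s)| ≤ ε * ((t - s) + 1 / √(n : ℝ)))
    (hμ : Tendsto (fun n => ecdf (x n) μ) atTop (𝓝 p)) {α : ℝ} (hα : 0 < α) {M₀ : ℝ}
    (hM : Tendsto (fun n : ℕ => (n : ℝ)⁻¹ * ∑ i : Fin n, |x n i| ^ α) atTop (𝓝 M₀))
    {m : ℕ → ℕ} (hm : Tendsto m atTop atTop) (hmn : ∀ᶠ n in atTop, m n ≤ n) :
    Tendsto (fun n => bootVariance p (m n) (x n)) atTop (𝓝 (p * (1 - p) / f₀ ^ 2)) ∧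
    ∀ (t : ℕ → ℝ) (t₀ : ℝ), Tendsto t atTop (𝓝 t₀) →
      Tendsto (fun n => (resampleLaw (m n) (x n)).real
        {y | √(m n : ℝ) * (sampleQuantile p y - sampleQuantile p (x n)) ≤ t n}) atTop
      (𝓝 ((gaussianReal 0 (p * (1 - p) / f₀ ^ 2).toNNReal).real (Set.Iic t₀))) := by
  obtain ⟨hcons, hrec⟩ := tendsto_sampleQuantile_and_abs_ecdf_sub_le hp0 hp1 hf₀ hlin hμ
  -- the empirical law of an empty sample is not a probability measure, hence the shift
  set ν : ℕ → Measure ℝ := fun n => empiricalMeasure (x (n + 1)) with hν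
  have hprob : ∀ n, IsProbabilityMeasure (ν n) := fun n =>
    isProbabilityMeasure_empiricalMeasure n.succ_ne_zero _
  have hm1 : Tendsto (fun n => m (n + 1)) atTop atTop := (tendsto_add_atTop_iff_nat 1).2 hm
  set c : ℕ → ℝ := fun n => sampleQuantile p (x (n + 1)) with hc
  have hc1 : Tendsto c atTop (𝓝 μ) :=
    (tendsto_add_atTop_iff_nat (f := fun n => sampleQuantile p (x n)) 1).2 hcons
  have hloc : ∀ ε > 0, ∃ δ > 0, ∀ᶠ n in atTop, ∀ u, |u| ≤ δ →
      |(ν n).real (Set.Iic (c n + u)) - p - f₀ * u| ≤ ε * (|u| + 1 / √(m (n + 1) : ℝ)) := by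
    intro ε hε
    obtain ⟨δ, hδ, hev⟩ := hrec ε hε
    refine ⟨δ, hδ, ?_⟩
    filter_upwards [(tendsto_add_atTop_nat 1).eventually hev,
      (tendsto_add_atTop_nat 1).eventually hmn, hm1.eventually_ne_atTop 0] with n h1 h2 h3 u hu
    simp only [hν, measureReal_Iic_empiricalMeasure]
    refine (h1 u hu).trans ?_
    gcongr
  have hint : ∀ n, Integrable (fun x : ℝ => |x| ^ α) (ν n) := fun n => by
    simp only [hν, empiricalMeasure]
    refine Integrable.smul_measure ?_ (by simp)
    exact integrable_finsetSum_measure.2 fun i _ => integrable_dirac (by simp)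
  have hMev : ∀ᶠ n in atTop, ∫ x, |x| ^ α ∂(ν n) ≤ M₀ + 1 := by
    filter_upwards [(tendsto_add_atTop_nat 1).eventually
      (hM.eventually_le_const (lt_add_one M₀))] with n hn
    simp only [hν, integral_empiricalMeasure]
    exact hn
  have hcB : ∀ᶠ n in atTop, |c n| ≤ |μ| + 1 := hc1.abs.eventually_le_const (lt_add_one _)
  constructor
  · refine (tendsto_add_atTop_iff_nat (f := fun n => bootVariance p (m n) (x n)) 1).1 ?_
    exact tendsto_variance_sqrt_mul_sampleQuantile_sub hp0 hp1 ν hm1 c hf₀ hloc hα hcB hint hMev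
  · intro t t₀ ht
    refine (tendsto_add_atTop_iff_nat (f := fun n => (resampleLaw (m n) (x n)).real
        {y | √(m n : ℝ) * (sampleQuantile p y - sampleQuantile p (x n)) ≤ t n}) 1).1 ?_
    exact tendsto_measureReal_sqrt_mul_sampleQuantile_sub_le hp0 hp1 ν hm1 c hf₀ hloc
      ((tendsto_add_atTop_iff_nat 1).2 ht)

theorem tendsto_resampleLaw_studentized_le {p : ℝ} (hp0 : 0 < p) (hp1 : p < 1)
    {x : (n : ℕ) → Fin n → ℝ} {f₀ : ℝ} (hf₀ : 0 < f₀) {m : ℕ → ℕ}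
    (hvar : Tendsto (fun n => bootVariance p (m n) (x n)) atTop (𝓝 (p * (1 - p) / f₀ ^ 2)))
    (hlaw : ∀ (t : ℕ → ℝ) (t₀ : ℝ), Tendsto t atTop (𝓝 t₀) →
      Tendsto (fun n => (resampleLaw (m n) (x n)).real
        {y | √(m n : ℝ) * (sampleQuantile p y - sampleQuantile p (x n)) ≤ t n}) atTop
      (𝓝 ((gaussianReal 0 (p * (1 - p) / f₀ ^ 2).toNNReal).real (Set.Iic t₀)))) (t : ℝ) :
    Tendsto (fun n => (resampleLaw (m n) (x n)).real {y | studentized p (x n) y ≤ t}) atTop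
      (𝓝 ((gaussianReal 0 1).real (Set.Iic t))) := by
  have hpp : 0 < p * (1 - p) := mul_pos hp0 (by linarith)
  have hv : 0 < p * (1 - p) / f₀ ^ 2 := by positivity
  have hlim := hlaw (fun n => t * √(bootVariance p (m n) (x n))) (t * √(p * (1 - p) / f₀ ^ 2))
    (((Real.continuous_sqrt.tendsto _).comp hvar).const_mul t)
  have hstd : (gaussianReal 0 (p * (1 - p) / f₀ ^ 2).toNNReal).real
      (Set.Iic (t * √(p * (1 - p) / f₀ ^ 2))) = (gaussianReal 0 1).real (Set.Iic t) := by
    have h1 := gaussianReal_Iic_eq hf₀ hpp.le (t * √(p * (1 - p) / f₀ ^ 2))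
    have h2 := gaussianReal_Iic_eq (Real.sqrt_pos.2 hpp) hpp.le t
    rw [Real.sq_sqrt hpp.le, div_self hpp.ne', Real.toNNReal_one] at h2
    rw [← h1, ← h2]
    congr 2
    rw [Real.sqrt_div hpp.le, Real.sqrt_sq hf₀.le]
    field_simp
  rw [hstd] at hlim
  refine hlim.congr' ?_
  filter_upwards [hvar.eventually_const_lt hv] with n hn
  congr 1
  ext y
  simp only [Set.mem_ofPred_eq, studentized]
  rw [div_le_iff₀ (Real.sqrt_pos.2 hn)]

/-- Passage from conditional to unconditional limits: the probability of a joint event is the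
expectation of its conditional probability, which converges boundedly. -/
theorem tendsto_measure_of_tendsto_condDistrib {Ω : Type*} [MeasurableSpace Ω] {P : Measure Ω}
    [IsProbabilityMeasure P] {E F : ℕ → Type*} [∀ n, MeasurableSpace (E n)]
    [∀ n, MeasurableSpace (F n)] [∀ n, StandardBorelSpace (F n)] [∀ n, Nonempty (F n)]
    {X : (n : ℕ) → Ω → E n} {Y : (n : ℕ) → Ω → F n} (hX : ∀ n, AEMeasurable (X n) P)
    (hY : ∀ n, AEMeasurable (Y n) P) {S : (n : ℕ) → Set (E n × F n)}
    (hS : ∀ n, MeasurableSet (S n)) {a : ENNReal}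
    (h : ∀ᵐ ω ∂P, Tendsto (fun n => condDistrib (Y n) (X n) P (X n ω)
      {y | (X n ω, y) ∈ S n}) atTop (𝓝 a)) :
    Tendsto (fun n => P {ω | (X n ω, Y n ω) ∈ S n}) atTop (𝓝 a) := by
  have hmeas : ∀ n, Measurable fun x => condDistrib (Y n) (X n) P x {y | (x, y) ∈ S n} :=
    fun n => Kernel.measurable_kernel_prodMk_left (hS n)
  have heq : ∀ n, P {ω | (X n ω, Y n ω) ∈ S n}
      = ∫⁻ ω, condDistrib (Y n) (X n) P (X n ω) {y | (X n ω, y) ∈ S n} ∂P := by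
    intro n
    calc P {ω | (X n ω, Y n ω) ∈ S n} = P.map (fun ω => (X n ω, Y n ω)) (S n) := by
          rw [Measure.map_apply_of_aemeasurable ((hX n).prodMk (hY n)) (hS n)]
          rfl
      _ = ∫⁻ x, condDistrib (Y n) (X n) P x {y | (x, y) ∈ S n} ∂(P.map (X n)) := by
          rw [← compProd_map_condDistrib (hY n), Measure.compProd_apply (hS n)]
          rfl
      _ = _ := lintegral_map' (hmeas n).aemeasurable (hX n)
  simp_rw [heq]
  have hlim : ∫⁻ _ω, a ∂P = a := by simp
  rw [← hlim]
  exact tendsto_lintegral_of_dominated_convergence' (fun _ => 1)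
    (fun n => (hmeas n).comp_aemeasurable (hX n))
    (fun n => ae_of_all _ fun ω => prob_le_one) (by simp) h

/-- The two limits conditional on the data, for almost every realization of the data. -/
theorem ae_tendsto_bootVariance_and_studentized {Ω : Type*} [MeasurableSpace Ω] {P : Measure Ω}
    [IsProbabilityMeasure P] {ν : Measure ℝ} [IsProbabilityMeasure ν] {X : ℕ → Ω → ℝ}
    (hX : ∀ i, HasLaw (X i) ν P) (hindep : iIndepFun X P) {p : ℝ} (hp0 : 0 < p) (hp1 : p < 1)
    {μ : ℝ} (hμ : IsUniqueQuantile ν p μ) {f : ℝ → ℝ} (hf : HasPosContDensityNear ν f μ)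
    {α : ℝ} (hα : 0 < α) (hmom : Integrable (fun x : ℝ => |x| ^ α) ν)
    {m : ℕ → ℕ} (hm : Tendsto m atTop atTop)
    (hmn : (fun n => (m n : ℝ)) =o[atTop] (fun n : ℕ => (n : ℝ))) :
    ∀ᵐ ω ∂P, Tendsto (fun n => bootVariance p (m n) (fun i : Fin n => X i ω)) atTop
        (𝓝 (p * (1 - p) / f μ ^ 2)) ∧
      ∀ t : ℝ, Tendsto (fun n => (resampleLaw (m n) (fun i : Fin n => X i ω)).real
        {y | studentized p (fun i : Fin n => X i ω) y ≤ t}) atTop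
        (𝓝 ((gaussianReal 0 1).real (Set.Iic t))) := by
  have hpos : 0 < f μ := by
    obtain ⟨U, -, hμU, -, hpos, -⟩ := hf
    exact hpos μ hμU
  have hFμ := measureReal_Iic_eq_of_isUniqueQuantile hμ hf
  have hle : ∀ᶠ n in atTop, m n ≤ n := by
    filter_upwards [hmn.bound one_pos] with n hn
    simpa using hn
  have hmean : ∀ᵐ ω ∂P, Tendsto (fun n => ecdf (fun i : Fin n => X i ω) μ) atTop (𝓝 p) := by
    have h := ae_tendsto_sampleMean hX hindep
      (g := (Set.Iic μ).indicator fun _ => 1) (measurable_const.indicator measurableSet_Iic)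
      ((integrable_const _).indicator measurableSet_Iic)
    rw [integral_indicator_const _ measurableSet_Iic, hFμ, smul_eq_mul, mul_one] at h
    exact h
  have hmoment := ae_tendsto_sampleMean hX hindep (g := fun x => |x| ^ α)
    (measurable_norm.pow_const α) hmom
  filter_upwards [ae_exists_abs_ecdf_sub_le hX hindep hf, hmean, hmoment] with ω h1 h2 h3
  have h := tendsto_bootVariance_and_resampleLaw hp0 hp1 (x := fun n (i : Fin n) => X i ω) hpos
    h1 h2 hα h3 hm hle
  exact ⟨h.1, tendsto_resampleLaw_studentized_le hp0 hp1 (x := fun n (i : Fin n) => X i ω) hpos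
    h.1 h.2⟩

end QuantileBootstrap

theorem theorem1 {Ω : Type*} [MeasurableSpace Ω] (P : Measure Ω) [IsProbabilityMeasure P]
    -- the i.i.d. data `X 0, X 1, …` with common law `ν`
    (ν : Measure ℝ) [IsProbabilityMeasure ν] (X : ℕ → Ω → ℝ)
    (hX : ∀ i, HasLaw (X i) ν P) (hindep : iIndepFun X P)
    -- the unique `p`-th quantile, the local density, smoothness, and the moment condition
    (p : ℝ) (hp0 : 0 < p) (hp1 : p < 1) (μ : ℝ)
    (hμ : QuantileBootstrap.IsUniqueQuantile ν p μ)
    (f : ℝ → ℝ) (hf : QuantileBootstrap.HasPosContDensityNear ν f μ)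
    (hF : QuantileBootstrap.SobolevSmoothAt 1 μ (fun x => cdf ν x))
    (α : ℝ) (hα : 0 < α) (hmom : Integrable (fun x : ℝ => |x| ^ α) ν)
    -- the resample sizes
    (m : ℕ → ℕ) (hm : Tendsto m atTop atTop)
    (hmn : (fun n => (m n : ℝ)) =o[atTop] (fun n : ℕ => (n : ℝ)))
    -- the resamples: given `X 0, …, X (n - 1)`, the variables `Xs n j`, `j < m n`, are i.i.d.
    -- draws from the empirical distribution of `X 0, …, X (n - 1)`
    (Xs : (n : ℕ) → Fin (m n) → Ω → ℝ) (hXs : ∀ n j, AEMeasurable (Xs n j) P)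
    (hboot : ∀ n, n ≠ 0 →
      ∀ᵐ x ∂(P.map (fun ω (i : Fin n) => X i ω)),
        condDistrib (fun ω j => Xs n j ω) (fun ω (i : Fin n) => X i ω) P x
          = QuantileBootstrap.resampleLaw (m n) x) :
    -- almost sure convergence of the conditional bootstrap variance
    (∀ᵐ ω ∂P, Tendsto
      (fun n => QuantileBootstrap.bootVariance p (m n) (fun i : Fin n => X i ω)) atTop
      (𝓝 (p * (1 - p) / f μ ^ 2))) ∧
    -- convergence in distribution of the Studentized bootstrap quantile
    TendstoInDistribution
      (fun n ω => QuantileBootstrap.studentized p (fun i : Fin n => X i ω) (fun j => Xs n j ω))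
      atTop (id : ℝ → ℝ) (fun _ => P) (gaussianReal 0 1) ∧
    -- the same, conditionally on the data, for almost every realization of the data
    (∀ᵐ ω ∂P, ∀ t : ℝ, Tendsto
      (fun n => (QuantileBootstrap.resampleLaw (m n) (fun i : Fin n => X i ω)).real
        {y | QuantileBootstrap.studentized p (fun i : Fin n => X i ω) y ≤ t}) atTop
      (𝓝 (cdf (gaussianReal 0 1) t))) := by
  have hcond := QuantileBootstrap.ae_tendsto_bootVariance_and_studentized hX hindep hp0 hp1 hμ hf hα
    hmom hm hmn
  have hXm : ∀ n : ℕ, AEMeasurable (fun ω (i : Fin n) => X i ω) P := fun n =>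
    aemeasurable_pi_lambda _ fun i => (hX i).aemeasurable
  have hYm : ∀ n : ℕ, AEMeasurable (fun ω j => Xs n j ω) P := fun n =>
    aemeasurable_pi_lambda _ fun j => hXs n j
  have hT : ∀ n, AEMeasurable (fun ω => QuantileBootstrap.studentized p
      (fun i : Fin n => X i ω) (fun j => Xs n j ω)) P := fun n =>
    QuantileBootstrap.aemeasurable_studentized hp0 hp1.le (hXm n) (hYm n)
  have hbootP : ∀ᵐ ω ∂P, ∀ n : ℕ, n ≠ 0 →
      condDistrib (fun ω j => Xs n j ω) (fun ω (i : Fin n) => X i ω) P (fun i : Fin n => X i ω)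
        = QuantileBootstrap.resampleLaw (m n) (fun i : Fin n => X i ω) := by
    rw [ae_all_iff]
    intro n
    rw [eventually_imp_distrib_left]
    exact fun hn => ae_of_ae_map (hXm n) (hboot n hn)
  refine ⟨hcond.mono fun ω h => h.1, ⟨hT, by fun_prop, ?_⟩, hcond.mono fun ω h t => ?_⟩
  · refine QuantileBootstrap.tendsto_probabilityMeasure_of_tendsto_Iic fun t => ?_
    have huncond := QuantileBootstrap.tendsto_measure_of_tendsto_condDistrib hXm hYm
      (S := fun n => {z | QuantileBootstrap.studentized p z.1 z.2 ≤ t})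
      (fun n => measurableSet_le (QuantileBootstrap.measurable_studentized hp0 hp1.le (m n) n)
        measurable_const) (a := gaussianReal 0 1 (Set.Iic t)) ?_
    · have hreal := (ENNReal.tendsto_toReal (measure_ne_top (gaussianReal 0 1) _)).comp huncond
      simp only [ProbabilityMeasure.coe_mk, Measure.map_id]
      refine hreal.congr fun n => ?_
      rw [map_measureReal_apply_of_aemeasurable (hT n) measurableSet_Iic]
      rfl
    · filter_upwards [hcond, hbootP] with ω h1 h2
      have h3 := ENNReal.tendsto_ofReal (h1.2 t)
      rw [ofReal_measureReal] at h3
      refine h3.congr' ?_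
      filter_upwards [eventually_ne_atTop 0] with n hn
      have hprob := QuantileBootstrap.isProbabilityMeasure_empiricalMeasure hn
        (fun i : Fin n => X i ω)
      rw [h2 n hn]
      refine ofReal_measureReal ?_
      simp only [QuantileBootstrap.resampleLaw]
      exact measure_ne_top _ _
  · rw [cdf_eq_real]
    exact h.2 t
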